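/- Let $\sigma_0=I$ and let $\sigma_1,\sigma_2,\sigma_3$ be the Pauli matrices. For $\boldsymbol a\in\mathbb R^3$ and a real $3\times3$ matrix $T$ put $$\rho(\boldsymbol a,T)=\tfrac14\Big(I\otimes I+\boldsymbol a\cdot\boldsymbol\sigma\otimes I+\sum_{i,j=1}^3T_{ij}\,\sigma_i\otimes\sigma_j\Big),$$ where the first tensor factor is Alice's qubit and the second is Bob's. A two-qubit state $\rho$ is called non-steerable (from Alice to Bob, by projective measurements) if there are a probability measure $\mu$ and qubit states $\sigma_\lambda$ such that for every projective measurement $\{\Pi_i\}_i$ of Alice there are response functions $p(i|\lambda)\ge0$ with $\sum_ip(i|\lambda)=1$ and $$\operatorname{Tr}_A[(\Pi_i\otimes I)\rho]=\int p(i|\lambda)\,\sigma_\lambda\,d\mu(\lambda)\quad\text{for all } i.$$ For $u,v\in\mathbb R$ let $\Phi_{u,v}$ be the linear map on $\mathbb C^{2\times2}$ with $\Phi_{u,v}(I)=I+\sin u\sin v\,\sigma_3$, $\Phi_{u,v}(\sigma_1)=\cos u\,\sigma_1$, $\Phi_{u,v}(\sigma_2)=\cos v\,\sigma_2$, $\Phi_{u,v}(\sigma_3)=\cos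 u\cos v\,\sigma_3$. For a real diagonal matrix $T$ put $$\mathcal I(T)=\frac1{2\pi}\iint_{S^2}\sqrt{\hat{\boldsymbol x}^\top T^2\hat{\boldsymbol x}}\;d^2\hat{\boldsymbol x};$$ a state $\rho(\boldsymbol 0,T)$ is called a border $T$-state if $\mathcal I(T)=1$. Let $0<a<1$ and $$B(a)=\frac1{\sqrt{1-a}}+\sqrt{\frac{1-a}{a}}\;\operatorname{arcsinh}\sqrt{\frac a{1-a}},\qquad \xi^*(a)=\sqrt{1-a}\;B(a)^{-1}.$$ (i) Let $|\boldsymbol a|=a$ and $\xi\in\mathbb R$, and suppose that $\rho(\boldsymbol a,-\xi I)$ is a state. If $\xi\le(1-a)\,B(a)^{-1}$, then $\rho(\boldsymbol a,-\xi I)$ is non-steerable. More generally, this holds whenever $\xi\le\xi^*(a)$. (ii) Let $u$ be any real number with $\sin^2u=a$. Then $\Phi_{u,u}$ is an extreme point of the convex set of completely positive trace-preserving maps on a qubit. For every $0\le\xi\le\xi^*(a)$ there is a diagonal $T$ such that $\rho(\boldsymbol 0,T)$ is a state, $\mathcal I(T)\le1$, $(\Phi_{u,u}\otimes\mathrm{id})\,\rho(\boldsymbol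 0,T)=\rho(a\hat{\boldsymbol e}_z,-\xi I)$, and $\mathcal I(T)=1$ if and only if $\xi=\xi^*(a)$. Thus the states with $\xi=\xi^*(a)$ are images of border $T$-states. -/

import Mathlib

open MeasureTheory
open scoped ComplexOrder Kronecker Matrix

noncomputable section

namespace QubitSteering

/-- Operators on one qubit. -/
abbrev Op : Type := Matrix (Fin 2) (Fin 2) ℂ

/-- Operators on two qubits; the first factor is Alice's, the second one Bob's. -/
abbrev Op2 : Type := Matrix (Fin 2 × Fin 2) (Fin 2 × Fin 2) ℂ

/-- Three-dimensional Euclidean space, which contains the Bloch vectors. -/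
abbrev E3 : Type := EuclideanSpace ℝ (Fin 3)

/-- The matrices `σ₀ = I, σ₁, σ₂, σ₃`. -/
def pauli : Fin 4 → Op :=
  ![1, !![0, 1; 1, 0], !![0, -Complex.I; Complex.I, 0], !![1, 0; 0, -1]]

/-- Density operators: positive semidefinite of trace one. -/
def IsState {ι : Type} [Fintype ι] (ρ : Matrix ι ι ℂ) : Prop :=
  ρ.PosSemidef ∧ ρ.trace = 1

/-- The operator `(I ⊗ I + a·σ ⊗ I + ∑ᵢⱼ Tᵢⱼ σᵢ ⊗ σⱼ) / 4`, in which Bob's Bloch vector is zero. -/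
def blochState (a : E3) (T : Matrix (Fin 3) (Fin 3) ℝ) : Op2 :=
  (1 / 4 : ℂ) • ((1 : Op) ⊗ₖ (1 : Op)
    + (∑ i : Fin 3, (a i : ℂ) • (pauli i.succ ⊗ₖ (1 : Op)))
    + ∑ i : Fin 3, ∑ j : Fin 3, (T i j : ℂ) • (pauli i.succ ⊗ₖ pauli j.succ))

/-- The displaced Werner operator with Alice's Bloch vector `a` and correlation matrix `-ξ I`. -/
def displacedWerner (a : E3) (ξ : ℝ) : Op2 := blochState a (-(ξ • 1))

/-- The `T`-state operator with correlation matrix `diag t`. -/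
def tState (t : Fin 3 → ℝ) : Op2 := blochState 0 (Matrix.diagonal t)

/-- The unit vector in the `z`-direction. -/
def ez : E3 := EuclideanSpace.single 2 1

/-! ### Steering -/

/-- The partial trace over Alice's qubit. -/
def traceA (X : Op2) : Op := Matrix.of fun j k => ∑ i : Fin 2, X (i, j) (i, k)

/-- Bob's unnormalised conditional state `Tr_A[(E ⊗ I) ρ]` when Alice's outcome has effect `E`. -/
def conditionalState (ρ : Op2) (E : Op) : Op := traceA ((E ⊗ₖ (1 : Op)) * ρ)

/-- A projective measurement with `n` outcomes on one qubit: mutually orthogonal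
orthogonal projections (possibly zero) that sum to the identity. -/
def IsProjectiveMeasurement {n : ℕ} (P : Fin n → Op) : Prop :=
  (∀ i, IsStarProjection (P i)) ∧ (∀ i j, i ≠ j → P i * P j = 0) ∧ ∑ i, P i = 1

/-- `ρ` is non-steerable from Alice to Bob by projective measurements: one ensemble `(μ, σ)` of
local hidden states of Bob reproduces, through response functions `p`, the assemblages of all
the projective measurements of Alice. -/
def NonSteerable (ρ : Op2) : Prop :=
  ∃ (Λ : Type) (_ : MeasurableSpace Λ) (μ : Measure Λ) (σ : Λ → Op),
    IsProbabilityMeasure μ ∧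
    (∀ j k, Measurable fun l => σ l j k) ∧
    (∀ l, IsState (σ l)) ∧
    ∀ (n : ℕ) (P : Fin n → Op), IsProjectiveMeasurement P →
      ∃ p : Fin n → Λ → ℝ,
        (∀ i, Measurable (p i)) ∧
        (∀ i l, 0 ≤ p i l) ∧
        (∀ l, ∑ i, p i l = 1) ∧
        ∀ i j k, conditionalState ρ (P i) j k = ∫ l, (p i l : ℂ) * σ l j k ∂μ

/-- The left-hand side `(1/2π) ∬ √(x̂ᵀ T² x̂) d²x̂` of the equation that defines the border
`T`-states; the integral is over the unit sphere with its surface measure. -/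
def borderIntegral (T : Matrix (Fin 3) (Fin 3) ℝ) : ℝ :=
  1 / (2 * Real.pi) *
    ∫ x : Metric.sphere (0 : E3) 1,
      Real.sqrt ((x : E3).ofLp ⬝ᵥ ((T ^ 2) *ᵥ (x : E3).ofLp)) ∂(volume : Measure E3).toSphere

/-! ### Qubit channels -/

/-- The map `Φ ⊗ id` on operators of a qubit together with an `ι`-dimensional system. -/
def applyA {ι : Type} (Φ : Op →ₗ[ℂ] Op) (X : Matrix (Fin 2 × ι) (Fin 2 × ι) ℂ) :
    Matrix (Fin 2 × ι) (Fin 2 × ι) ℂ :=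
  Matrix.of fun r s => Φ (Matrix.of fun i i' => X (i, r.2) (i', s.2)) r.1 s.1

/-- Completely positive trace-preserving maps on one qubit. -/
def IsCPTP (Φ : Op →ₗ[ℂ] Op) : Prop :=
  (∀ (n : ℕ) (X : Matrix (Fin 2 × Fin n) (Fin 2 × Fin n) ℂ),
    X.PosSemidef → (applyA Φ X).PosSemidef) ∧
  ∀ X : Op, (Φ X).trace = X.trace

/-- The linear map with `Φ(σ_ν) = ∑_μ M_{μν} σ_μ`; the coordinates of `X` in the Pauli basis
are `Tr(σ_ν X) / 2`. -/
def pauliMap (M : Matrix (Fin 4) (Fin 4) ℝ) : Op →ₗ[ℂ] Op where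
  toFun X := ∑ m : Fin 4, ∑ n : Fin 4, ((M m n : ℂ) * ((pauli n * X).trace / 2)) • pauli m
  map_add' X Y := by
    simp only [Matrix.trace_add, add_div, mul_add, add_smul,
      Finset.sum_add_distrib]
  map_smul' c X := by
    simp only [Matrix.mul_smul, Matrix.trace_smul, smul_eq_mul, RingHom.id_apply,
      Finset.smul_sum, smul_smul]
    refine Finset.sum_congr rfl fun m _ => Finset.sum_congr rfl fun n _ => ?_
    congr 1
    ring

/-- The matrix of the extremal qubit channel with parameters `u, v` in the Pauli basis. -/
def extremalMatrix (u v : ℝ) : Matrix (Fin 4) (Fin 4) ℝ :=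
  !![1, 0, 0, 0;
     0, Real.cos u, 0, 0;
     0, 0, Real.cos v, 0;
     Real.sin u * Real.sin v, 0, 0, Real.cos u * Real.cos v]

/-- The extremal qubit channel with parameters `u, v`. -/
def extremalChannel (u v : ℝ) : Op →ₗ[ℂ] Op := pauliMap (extremalMatrix u v)

/-- The quantity `1/√(1-a) + √((1-a)/a) · arcsinh √(a/(1-a))`. -/
def bracket (a : ℝ) : ℝ :=
  1 / Real.sqrt (1 - a) + Real.sqrt ((1 - a) / a) * Real.arsinh (Real.sqrt (a / (1 - a)))

end QubitSteering

end

/-!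
A local hidden state model for `ρ(a, T)` is built from linear maps `L` and `Q` with
`L (Q m) = Tᵀ m`. The hidden states are spread over the unit sphere with a density proportional to
`‖L x‖`, the one at `x` pointing in the direction `L x`, and the outcome `+` of Alice's measurement
along `m` has probability `(1 + ⟪a, m⟫ + c ‖Q m‖ sign ⟪Q m, x⟫) / 2`, where `c` is twice the mean of
`‖L x‖`. Integrating `sign ⟪q, x⟫ x` over a sphere gives a multiple of `q / ‖q‖`, so the model
reproduces the correlations `T`; its only constraint is `|⟪a, m⟫| + c ‖Q m‖ ≤ ‖m‖`. For `T = -ξ I`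
with `ξ > 0`, the maps `L` and `Q` are symmetric about the direction of `a`, and the best ratio of
their axes is `√(1 - a)`, which gives `ξ*(a)`; the mean of `‖L x‖` is found from Archimedes' theorem
that the projection of the sphere to an axis is uniformly distributed. For `ξ ≤ 0` the state is a
mixture of product states.

The two Kraus operators of `Φ_{u,u}` have linearly independent products `Kᵢᴴ Kⱼ`, which is Choi's
criterion for extremality, and `Φ_{u,u} ⊗ id` maps `ρ(0, diag(t₁, t₂, t₃))` to the operator with
Alice's Bloch vector `sin² u · e_z` and correlations `diag(t₁ cos u, t₂ cos u, t₃ cos² u)`.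
-/

noncomputable section

namespace QubitSteering

section Sphere

open Metric Set
open scoped Pointwise

variable {E : Type*} [NormedAddCommGroup E] [InnerProductSpace ℝ E]

/-- The action of a linear isometry on the unit sphere. -/
def sphereEquiv (g : E ≃ₗᵢ[ℝ] E) : sphere (0 : E) 1 ≃ₜ sphere (0 : E) 1 :=
  g.toHomeomorph.subtype fun x => by simp

lemma image_sphereEquiv_preimage (g : E ≃ₗᵢ[ℝ] E) (s : Set (sphere (0 : E) 1)) :
    ((↑) '' (sphereEquiv g ⁻¹' s) : Set E) = g ⁻¹' ((↑) '' s) := by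
  ext x
  simp only [mem_image, mem_preimage, Subtype.exists, exists_and_right, exists_eq_right,
    mem_sphere_zero_iff_norm, ← g.norm_map x]
  rfl

variable [FiniteDimensional ℝ E] [MeasurableSpace E] [BorelSpace E]

lemma measurePreserving_sphereEquiv (g : E ≃ₗᵢ[ℝ] E) :
    MeasurePreserving (sphereEquiv g) (volume : Measure E).toSphere
      (volume : Measure E).toSphere := by
  refine ⟨(sphereEquiv g).measurable, Measure.ext fun s hs => ?_⟩
  have h_cone : Ioo (0 : ℝ) 1 • (g ⁻¹' ((↑) '' s)) =
      g ⁻¹' (Ioo (0 : ℝ) 1 • ((↑) '' s : Set E)) := by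
    ext x
    simp only [mem_smul, mem_preimage]
    constructor
    · rintro ⟨r, hr, y, hy, rfl⟩
      exact ⟨r, hr, g y, hy, (map_smul g r y).symm⟩
    · rintro ⟨r, hr, y, hy, hxy⟩
      exact ⟨r, hr, g.symm y, by simpa using hy, by rw [← map_smul, hxy, g.symm_apply_apply]⟩
  rw [Measure.map_apply (sphereEquiv g).measurable hs,
    Measure.toSphere_apply' _ ((sphereEquiv g).measurable hs), Measure.toSphere_apply' _ hs,
    image_sphereEquiv_preimage, h_cone,
    g.measurePreserving.measure_preimage_emb g.toHomeomorph.measurableEmbedding]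

lemma integral_sphere_comp_isometry {F : Type*} [NormedAddCommGroup F] [NormedSpace ℝ F]
    (g : E ≃ₗᵢ[ℝ] E) (f : E → F) :
    ∫ x : sphere (0 : E) 1, f (g x) ∂(volume : Measure E).toSphere =
      ∫ x : sphere (0 : E) 1, f x ∂(volume : Measure E).toSphere :=
  (measurePreserving_sphereEquiv g).integral_comp
    (sphereEquiv g).measurableEmbedding fun x : sphere (0 : E) 1 => f x

lemma integral_sphere_eq_zero_of_comp_isometry_eq_neg {F : Type*} [NormedAddCommGroup F]
    [NormedSpace ℝ F] (g : E ≃ₗᵢ[ℝ] E) {f : E → F} (hf : ∀ x, f (g x) = -f x) :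
    ∫ x : sphere (0 : E) 1, f x ∂(volume : Measure E).toSphere = 0 := by
  have : IsAddTorsionFree F := .of_isTorsionFree ℝ F
  simp_rw [← self_eq_neg, ← integral_neg, ← hf, integral_sphere_comp_isometry]

end Sphere

section Archimedes

open Set Metric
open scoped Pointwise

lemma volume_plane_norm_sq_le (s : ℝ) :
    volume {y : EuclideanSpace ℝ (Fin 2) | ‖y‖ ^ 2 ≤ s} =
      ENNReal.ofReal Real.pi * ENNReal.ofReal s := by
  rcases lt_or_ge s 0 with hs | hs
  · have h_empty : {y : EuclideanSpace ℝ (Fin 2) | ‖y‖ ^ 2 ≤ s} = ∅ :=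
      eq_empty_of_forall_notMem fun y hy => (hs.trans_le (sq_nonneg ‖y‖)).not_ge hy
    rw [h_empty, measure_empty, ENNReal.ofReal_of_nonpos hs.le, mul_zero]
  · have h_disc : {y : EuclideanSpace ℝ (Fin 2) | ‖y‖ ^ 2 ≤ s} = closedBall 0 √s := by
      ext y
      rw [mem_ofPred_eq, mem_closedBall_zero_iff, Real.le_sqrt (norm_nonneg y) hs]
    rw [h_disc, EuclideanSpace.volume_closedBall_fin_two, mul_comm,
      ← ENNReal.ofReal_pow (Real.sqrt_nonneg s), Real.sq_sqrt hs]

lemma map_norm_sq_volume_plane :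
    (volume : Measure (EuclideanSpace ℝ (Fin 2))).map (fun y => ‖y‖ ^ 2) =
      ENNReal.ofReal Real.pi • (volume : Measure ℝ).restrict (Ioi 0) := by
  have h_Iic (s : ℝ) :
      (volume : Measure (EuclideanSpace ℝ (Fin 2))).map (fun y => ‖y‖ ^ 2) (Iic s) =
        ENNReal.ofReal Real.pi * ENNReal.ofReal s := by
    rw [Measure.map_apply (by fun_prop) measurableSet_Iic]
    exact volume_plane_norm_sq_le s
  have h_Iic' (s : ℝ) :
      (ENNReal.ofReal Real.pi • (volume : Measure ℝ).restrict (Ioi 0)) (Iic s) =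
        ENNReal.ofReal Real.pi * ENNReal.ofReal s := by
    rw [Measure.smul_apply, Measure.restrict_apply measurableSet_Iic, Iic_inter_Ioi,
      Real.volume_Ioc, sub_zero, smul_eq_mul]
  have h_fin (s : ℝ) : ENNReal.ofReal Real.pi * ENNReal.ofReal s ≠ ⊤ := by finiteness
  refine Measure.ext_of_Ioc' _ _ (fun a b _ => ne_top_of_le_ne_top (h_fin b)
    ((measure_mono Ioc_subset_Iic_self).trans_eq (h_Iic b))) fun a b hab => ?_
  have h_subset : Iic a ⊆ Iic b := Iic_subset_Iic.mpr hab.le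
  have h_null {μ : Measure ℝ} : NullMeasurableSet (Iic a) μ := measurableSet_Iic.nullMeasurableSet
  rw [← Iic_sdiff_Iic, measure_sdiff h_subset h_null (by rw [h_Iic]; exact h_fin a),
    measure_sdiff h_subset h_null (by rw [h_Iic']; exact h_fin a), h_Iic, h_Iic, h_Iic', h_Iic']

lemma exists_orthonormalBasis_apply_zero_eq {e : E3} (he : ‖e‖ = 1) :
    ∃ b : OrthonormalBasis (Fin 3) ℝ E3, b 0 = e := by
  obtain ⟨b, hb⟩ := Orthonormal.exists_orthonormalBasis_extension_of_card_eq (𝕜 := ℝ)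
    (ι := Fin 3) (v := fun _ => e) (s := {0}) (by simp) (by simp [he])
  exact ⟨b, hb 0 rfl⟩

lemma exists_measurePreserving_axis_plane {e : E3} (he : ‖e‖ = 1) :
    ∃ φ : E3 → ℝ × EuclideanSpace ℝ (Fin 2), MeasurePreserving φ ∧
      ∀ x, (φ x).1 = inner ℝ e x ∧ (φ x).1 ^ 2 + ‖(φ x).2‖ ^ 2 = ‖x‖ ^ 2 := by
  obtain ⟨b, rfl⟩ := exists_orthonormalBasis_apply_zero_eq he
  refine ⟨_, ((MeasurePreserving.id volume).prod (PiLp.volume_preserving_toLp (Fin 2))).comp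
    ((volume_preserving_piFinSuccAbove (fun _ => ℝ) 0).comp
      ((PiLp.volume_preserving_ofLp (Fin 3)).comp b.measurePreserving_repr)), fun x => ?_⟩
  have h_fst : b.repr x 0 = inner ℝ (b 0) x := b.repr_apply_apply x 0
  refine ⟨h_fst, ?_⟩
  rw [← b.repr.norm_map x, EuclideanSpace.norm_sq_eq, EuclideanSpace.norm_sq_eq,
    Fin.sum_univ_succ fun i => ‖b.repr x i‖ ^ 2, Real.norm_eq_abs (b.repr x 0), sq_abs]
  rfl

lemma volume_preimage_sq_add_norm_sq {t : Set ℝ} (ht : MeasurableSet t) (c : ℝ) :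
    volume ((fun y : EuclideanSpace ℝ (Fin 2) => c + ‖y‖ ^ 2) ⁻¹' t) =
      ENNReal.ofReal Real.pi * volume (t ∩ Ioi c) := by
  have h_shift : (fun s => c + s) ⁻¹' (t ∩ Ioi c) = (fun s => c + s) ⁻¹' t ∩ Ioi 0 := by
    rw [preimage_inter, preimage_const_add_Ioi, sub_self]
  rw [← measure_preimage_add volume c, h_shift,
    ← Measure.restrict_apply ((measurable_const_add c) ht), ← smul_eq_mul, ← Measure.smul_apply,
    ← map_norm_sq_volume_plane, Measure.map_apply (by fun_prop) ((measurable_const_add c) ht)]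
  rfl

lemma map_inner_norm_sq_volume {e : E3} (he : ‖e‖ = 1) :
    (volume : Measure E3).map (fun x => (inner ℝ e x, ‖x‖ ^ 2)) =
      ENNReal.ofReal Real.pi • (volume : Measure (ℝ × ℝ)).restrict {p | p.1 ^ 2 < p.2} := by
  obtain ⟨φ, hφ, hφe⟩ := exists_measurePreserving_axis_plane he
  have h_comp : (fun x : E3 => (inner ℝ e x, ‖x‖ ^ 2)) =
      (fun q : ℝ × EuclideanSpace ℝ (Fin 2) => (q.1, q.1 ^ 2 + ‖q.2‖ ^ 2)) ∘ φ :=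
    funext fun x => Prod.ext (hφe x).1.symm (hφe x).2.symm
  have h_region : MeasurableSet {p : ℝ × ℝ | p.1 ^ 2 < p.2} :=
    measurableSet_lt (by fun_prop) (by fun_prop)
  rw [h_comp, ← Measure.map_map (by fun_prop) hφ.measurable, hφ.map_eq]
  refine Measure.ext fun S hS => ?_
  rw [Measure.map_apply (by fun_prop) hS, Measure.volume_eq_prod,
    Measure.prod_apply ((by fun_prop : Measurable _) hS), Measure.smul_apply, smul_eq_mul,
    Measure.restrict_apply hS, Measure.volume_eq_prod, Measure.prod_apply (hS.inter h_region),
    ← lintegral_const_mul _ (measurable_measure_prodMk_left (hS.inter h_region))]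
  exact lintegral_congr fun z =>
    volume_preimage_sq_add_norm_sq (measurable_prodMk_left hS) (z ^ 2)

lemma volume_setOf_sq_lt_div_sqrt_mem (B : Set ℝ) {s : ℝ} (hs : 0 < s) :
    volume {z : ℝ | z ^ 2 < s ∧ z / √s ∈ B} =
      ENNReal.ofReal √s * volume (B ∩ Ioo (-1) 1) := by
  have h_sqrt : 0 < √s := Real.sqrt_pos.mpr hs
  have h_preimage : {z : ℝ | z ^ 2 < s ∧ z / √s ∈ B} =
      (fun z => z * (√s)⁻¹) ⁻¹' (B ∩ Ioo (-1) 1) := by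
    ext z
    have h_sq : z ^ 2 < s ↔ z / √s ∈ Ioo (-1) 1 := by
      rw [mem_Ioo, ← abs_lt, abs_div, abs_of_pos h_sqrt, div_lt_one h_sqrt,
        Real.lt_sqrt (abs_nonneg z), sq_abs]
    rw [mem_ofPred_eq, h_sq, and_comm]
    rfl
  rw [h_preimage, Real.volume_preimage_mul_right (inv_ne_zero h_sqrt.ne'), inv_inv,
    abs_of_pos h_sqrt]

lemma setLIntegral_sqrt_Ioo : ∫⁻ s in Ioo 0 1, ENNReal.ofReal √s = ENNReal.ofReal (2 / 3) := by
  rw [← ofReal_integral_eq_lintegral_ofReal, ← integral_Ioc_eq_integral_Ioo,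
    ← intervalIntegral.integral_of_le zero_le_one]
  · simp only [Real.sqrt_eq_rpow]
    rw [integral_rpow (by norm_num)]
    norm_num
  · exact Real.continuous_sqrt.integrableOn_Icc.mono_set Ioo_subset_Icc_self
  · exact .of_forall Real.sqrt_nonneg

lemma volume_cone {e : E3} (he : ‖e‖ = 1) {B : Set ℝ} (hB : MeasurableSet B) :
    volume {x : E3 | ‖x‖ ^ 2 < 1 ∧ inner ℝ e x / √(‖x‖ ^ 2) ∈ B} =
      ENNReal.ofReal (2 * Real.pi / 3) * volume (B ∩ Ioo (-1) 1) := by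
  set S : Set (ℝ × ℝ) := {p | p.2 < 1 ∧ p.1 / √p.2 ∈ B}
  have h_meas : Measurable fun x : E3 => (inner ℝ e x, ‖x‖ ^ 2) := by fun_prop
  have h_ratio : Measurable fun p : ℝ × ℝ => p.1 / √p.2 := by fun_prop
  have hS : MeasurableSet S :=
    (measurableSet_lt measurable_snd measurable_const).inter (h_ratio hB)
  have h_region : MeasurableSet {p : ℝ × ℝ | p.1 ^ 2 < p.2} :=
    measurableSet_lt (by fun_prop) (by fun_prop)
  have h_section (s : ℝ) : volume ((fun z : ℝ => (z, s)) ⁻¹' (S ∩ {p | p.1 ^ 2 < p.2})) =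
      (Ioo 0 1).indicator (fun s => ENNReal.ofReal √s * volume (B ∩ Ioo (-1) 1)) s := by
    by_cases hs : s ∈ Ioo (0 : ℝ) 1
    · rw [indicator_of_mem hs, ← volume_setOf_sq_lt_div_sqrt_mem B hs.1]
      congr 1 with z
      simp [S, hs.2, and_comm]
    · have h_empty : (fun z : ℝ => (z, s)) ⁻¹' (S ∩ {p | p.1 ^ 2 < p.2}) = ∅ :=
        eq_empty_of_forall_notMem fun z hz => hs ⟨(sq_nonneg z).trans_lt hz.2, hz.1.1⟩
      rw [indicator_of_notMem hs, h_empty, measure_empty]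
  calc volume {x : E3 | ‖x‖ ^ 2 < 1 ∧ inner ℝ e x / √(‖x‖ ^ 2) ∈ B}
      = (volume : Measure E3).map (fun x => (inner ℝ e x, ‖x‖ ^ 2)) S :=
        (Measure.map_apply h_meas hS).symm
    _ = ENNReal.ofReal Real.pi * volume (S ∩ {p | p.1 ^ 2 < p.2}) := by
        rw [map_inner_norm_sq_volume he, Measure.smul_apply, Measure.restrict_apply hS, smul_eq_mul]
    _ = ENNReal.ofReal Real.pi * (ENNReal.ofReal (2 / 3) * volume (B ∩ Ioo (-1) 1)) := by
        rw [Measure.volume_eq_prod, Measure.prod_apply_symm (hS.inter h_region)]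
        simp only [h_section]
        rw [lintegral_indicator measurableSet_Ioo,
          lintegral_mul_const _ Real.continuous_sqrt.measurable.ennreal_ofReal,
          setLIntegral_sqrt_Ioo]
    _ = ENNReal.ofReal (2 * Real.pi / 3) * volume (B ∩ Ioo (-1) 1) := by
        rw [← mul_assoc, ← ENNReal.ofReal_mul Real.pi_pos.le]
        ring_nf

lemma Ioo_smul_sphere_inner_preimage (e : E3) (B : Set ℝ) :
    Ioo (0 : ℝ) 1 • ((↑) '' ((fun x : sphere (0 : E3) 1 => inner ℝ e (x : E3)) ⁻¹' B) : Set E3) =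
      {x : E3 | ‖x‖ ^ 2 < 1 ∧ inner ℝ e x / √(‖x‖ ^ 2) ∈ B} \ {0} := by
  ext x
  simp only [mem_smul, mem_image, mem_preimage, mem_sdiff, mem_ofPred_eq, mem_singleton_iff,
    Real.sqrt_sq (norm_nonneg x), sq_lt_one_iff₀ (norm_nonneg x)]
  constructor
  · rintro ⟨r, ⟨hr0, hr1⟩, _, ⟨y, hy, rfl⟩, rfl⟩
    have h_norm : ‖r • (y : E3)‖ = r := by
      rw [norm_smul, norm_eq_of_mem_sphere y, mul_one, Real.norm_of_nonneg hr0.le]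
    rw [h_norm, inner_smul_right, mul_div_cancel_left₀ _ hr0.ne', ← norm_eq_zero, h_norm]
    exact ⟨⟨hr1, hy⟩, hr0.ne'⟩
  · rintro ⟨⟨h_lt, hB⟩, h_ne⟩
    refine ⟨‖x‖, ⟨norm_pos_iff.mpr h_ne, h_lt⟩, ‖x‖⁻¹ • x,
      ⟨⟨‖x‖⁻¹ • x, by simp [norm_smul, h_ne]⟩, ?_, rfl⟩,
      smul_inv_smul₀ (norm_ne_zero_iff.mpr h_ne) x⟩
    rwa [inner_smul_right, ← div_eq_inv_mul]

theorem map_inner_toSphere {e : E3} (he : ‖e‖ = 1) :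
    (volume : Measure E3).toSphere.map (fun x : sphere (0 : E3) 1 => inner ℝ e (x : E3)) =
      ENNReal.ofReal (2 * Real.pi) • (volume : Measure ℝ).restrict (Ioo (-1) 1) := by
  have h_meas : Measurable fun x : sphere (0 : E3) 1 => inner ℝ e (x : E3) := by fun_prop
  refine Measure.ext fun B hB => ?_
  rw [Measure.map_apply h_meas hB, Measure.toSphere_apply' _ (h_meas hB),
    Ioo_smul_sphere_inner_preimage, measure_sdiff_null (measure_singleton _), volume_cone he hB,
    Measure.smul_apply, Measure.restrict_apply hB, smul_eq_mul, finrank_euclideanSpace_fin,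
    ← mul_assoc, ← ENNReal.ofReal_natCast, ← ENNReal.ofReal_mul (Nat.cast_nonneg _)]
  congr 2
  push_cast
  ring

lemma integral_sphere_comp_inner {e : E3} (he : ‖e‖ = 1) {f : ℝ → ℝ} (hf : Measurable f) :
    ∫ x : sphere (0 : E3) 1, f (inner ℝ e (x : E3)) ∂(volume : Measure E3).toSphere =
      2 * Real.pi * ∫ t in (-1)..1, f t := by
  rw [← integral_map (φ := fun x : sphere (0 : E3) 1 => inner ℝ e (x : E3)) (by fun_prop)
      hf.aestronglyMeasurable, map_inner_toSphere he, integral_smul_measure,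
    ENNReal.toReal_ofReal (by positivity), smul_eq_mul, ← integral_Ioc_eq_integral_Ioo,
    intervalIntegral.integral_of_le (by norm_num)]

end Archimedes

section Bloch

lemma inner_eq_sum (v w : E3) : inner ℝ v w = v 0 * w 0 + v 1 * w 1 + v 2 * w 2 := by
  simp [PiLp.inner_apply, Fin.sum_univ_three, mul_comm]

lemma norm_sq_eq_sum (m : E3) : ‖m‖ ^ 2 = m 0 ^ 2 + m 1 ^ 2 + m 2 ^ 2 := by
  rw [← real_inner_self_eq_norm_sq, inner_eq_sum]
  ring

lemma exists_norm_eq_one_and_eq_norm_smul (w : E3) : ∃ e : E3, ‖e‖ = 1 ∧ w = ‖w‖ • e := by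
  rcases eq_or_ne w 0 with rfl | hw
  · exact ⟨ez, by simp [ez], by simp⟩
  · exact ⟨‖w‖⁻¹ • w, norm_smul_inv_norm (𝕜 := ℝ) hw,
      (smul_inv_smul₀ (norm_ne_zero_iff.mpr hw) w).symm⟩

/-- The Hermitian operator `(t I + m·σ) / 2` with Bloch coordinates `(t, m)`. -/
def blochOp : ℝ × E3 →ₗ[ℝ] Op where
  toFun p := !![((p.1 : ℂ) + p.2 2) / 2, ((p.2 0 : ℂ) - p.2 1 * Complex.I) / 2;
    ((p.2 0 : ℂ) + p.2 1 * Complex.I) / 2, ((p.1 : ℂ) - p.2 2) / 2]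
  map_add' p q := by
    ext i j
    fin_cases i <;> fin_cases j <;> simp <;> ring
  map_smul' c p := by
    ext i j
    fin_cases i <;> fin_cases j <;> simp <;> ring

lemma blochOp_apply (t : ℝ) (m : E3) :
    blochOp (t, m) = !![((t : ℂ) + m 2) / 2, ((m 0 : ℂ) - m 1 * Complex.I) / 2;
      ((m 0 : ℂ) + m 1 * Complex.I) / 2, ((t : ℂ) - m 2) / 2] :=
  rfl

lemma isHermitian_blochOp (p : ℝ × E3) : (blochOp p).IsHermitian := by
  ext i j
  fin_cases i <;> fin_cases j <;> simp [blochOp, Complex.ext_iff]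

lemma exists_blochOp_eq_of_isHermitian {P : Op} (hP : P.IsHermitian) :
    ∃ (t : ℝ) (m : E3), blochOp (t, m) = P := by
  refine ⟨(P 0 0).re + (P 1 1).re,
    !₂[2 * (P 0 1).re, -2 * (P 0 1).im, (P 0 0).re - (P 1 1).re], ?_⟩
  have h00 : (P 0 0).im = 0 := Complex.conj_eq_iff_im.mp (hP.apply 0 0)
  have h11 : (P 1 1).im = 0 := Complex.conj_eq_iff_im.mp (hP.apply 1 1)
  ext i j
  fin_cases i <;> fin_cases j <;>
    simp [blochOp_apply, ← hP.apply 1 0, Complex.ext_iff, h00, h11]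
  ring

lemma trace_blochOp (t : ℝ) (m : E3) : (blochOp (t, m)).trace = t := by
  simp only [blochOp_apply, Matrix.trace_fin_two_of]
  ring

lemma trace_blochOp_mul (t s : ℝ) (m n : E3) :
    (blochOp (t, m) * blochOp (s, n)).trace = ((t * s + inner ℝ m n) / 2 : ℝ) := by
  simp only [blochOp_apply, Matrix.mul_fin_two, Matrix.trace_fin_two_of, inner_eq_sum]
  push_cast
  linear_combination (-(m 1 : ℂ) * n 1 / 2) * Complex.I_sq

lemma blochOp_mul_self (t : ℝ) (m : E3) :
    blochOp (t, m) * blochOp (t, m) = blochOp ((t ^ 2 + ‖m‖ ^ 2) / 2, t • m) := by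
  simp only [blochOp_apply, Matrix.mul_fin_two, norm_sq_eq_sum, PiLp.smul_apply, smul_eq_mul]
  ext i j
  fin_cases i <;> fin_cases j <;> simp [Complex.ext_iff, -Complex.ofReal_pow] <;> constructor <;>
    ring

lemma blochOp_injective : Function.Injective blochOp := by
  refine (injective_iff_map_eq_zero blochOp).mpr fun ⟨t, m⟩ h => ?_
  have h_trace := trace_blochOp_mul t t m m
  rw [h, mul_zero, Matrix.trace_zero, eq_comm, Complex.ofReal_eq_zero,
    real_inner_self_eq_norm_sq] at h_trace
  have ht : t = 0 := by nlinarith [sq_nonneg ‖m‖]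
  have hm : ‖m‖ ^ 2 = 0 := by nlinarith
  exact Prod.ext ht (norm_eq_zero.mp (pow_eq_zero_iff two_ne_zero |>.mp hm))

lemma eq_zero_or_norm_eq_one_of_isIdempotentElem {t : ℝ} {m : E3}
    (h : IsIdempotentElem (blochOp (t, m))) :
    (m = 0 ∧ (t = 0 ∨ t = 2)) ∨ (t = 1 ∧ ‖m‖ = 1) := by
  rw [IsIdempotentElem, blochOp_mul_self, blochOp_injective.eq_iff, Prod.mk.injEq] at h
  obtain ⟨h_scalar, h_vector⟩ := h
  rcases eq_or_ne m 0 with rfl | hm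
  · rw [norm_zero] at h_scalar
    have h_roots : t * (t - 2) = 0 := by linarith
    exact .inl ⟨rfl, (mul_eq_zero.mp h_roots).imp_right sub_eq_zero.mp⟩
  · have ht : t = 1 := smul_left_injective ℝ hm (h_vector.trans (one_smul ℝ m).symm)
    have h_norm : ‖m‖ ^ 2 = 1 := by rw [ht] at h_scalar; linarith
    exact .inr ⟨ht, (pow_eq_one_iff_of_nonneg (norm_nonneg m) two_ne_zero).mp h_norm⟩

lemma posSemidef_blochOp_one {e : E3} (he : ‖e‖ = 1) : (blochOp (1, e)).PosSemidef := by
  have h_idem : (blochOp (1, e))ᴴ * blochOp (1, e) = blochOp (1, e) := by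
    rw [(isHermitian_blochOp _).eq, blochOp_mul_self, he, one_smul]
    norm_num
  exact h_idem ▸ Matrix.posSemidef_conjTranspose_mul_self _

lemma posSemidef_blochOp {t : ℝ} {m : E3} (h : ‖m‖ ≤ t) : (blochOp (t, m)).PosSemidef := by
  obtain ⟨e, he, hm⟩ := exists_norm_eq_one_and_eq_norm_smul m
  -- a point of the forward cone is a combination of the antipodal null vectors `(1, ±e)`
  have h_split : blochOp (t, m) =
      ((t + ‖m‖) / 2) • blochOp (1, e) + ((t - ‖m‖) / 2) • blochOp (1, -e) := by
    rw [← map_smul, ← map_smul, ← map_add]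
    congr 1
    refine Prod.ext ?_ ?_
    · simp
      ring
    · nth_rw 1 [hm]
      simp only [Prod.smul_mk, Prod.snd_add]
      module
  rw [h_split]
  have h_norm := norm_nonneg m
  exact ((posSemidef_blochOp_one he).smul (by linarith)).add
    ((posSemidef_blochOp_one (by rwa [norm_neg])).smul (by linarith))

lemma isState_blochOp {m : E3} (hm : ‖m‖ ≤ 1) : IsState (blochOp (1, m)) :=
  ⟨posSemidef_blochOp hm, by rw [trace_blochOp, Complex.ofReal_one]⟩

lemma conditionalState_blochState (a : E3) (T : Matrix (Fin 3) (Fin 3) ℝ) (t : ℝ) (m : E3) :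
    conditionalState (blochState a T) (blochOp (t, m)) =
      (1 / 2 : ℝ) • blochOp (t + inner ℝ a m, Matrix.toEuclideanLin Tᵀ m) := by
  rw [inner_eq_sum]
  ext j k
  fin_cases j <;> fin_cases k <;>
    simp [conditionalState, traceA, blochState, pauli, Matrix.mul_apply, Fintype.sum_prod_type,
      Fin.sum_univ_succ, Matrix.one_apply, blochOp_apply, Complex.ext_iff, Matrix.toLpLin_apply,
      Matrix.mulVec, dotProduct] <;>
    constructor <;> ring

lemma integral_mul_blochOp {Λ : Type*} [MeasurableSpace Λ] {μ : Measure Λ} {p : Λ → ℝ}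
    {g : Λ → E3} (hp : Integrable p μ) (hpg : Integrable (fun l => p l • g l) μ) (j k : Fin 2) :
    ∫ l, (p l : ℂ) * blochOp (1, g l) j k ∂μ =
      blochOp (∫ l, p l ∂μ, ∫ l, p l • g l ∂μ) j k := by
  let entry : ℝ × E3 →L[ℝ] ℂ :=
    ((Matrix.entryLinearMap ℝ ℂ j k) ∘ₗ blochOp).toContinuousLinearMap
  calc ∫ l, (p l : ℂ) * blochOp (1, g l) j k ∂μ
      = ∫ l, entry (p l, p l • g l) ∂μ := by
        refine integral_congr_ae (.of_forall fun l => ?_)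
        have h_smul : (p l, p l • g l) = p l • (1, g l) := by simp
        simp only [h_smul, map_smul, Complex.real_smul]
        rfl
    _ = entry (∫ l, (p l, p l • g l) ∂μ) := entry.integral_comp_comm (hp.prodMk hpg)
    _ = blochOp (∫ l, p l ∂μ, ∫ l, p l • g l ∂μ) j k := by rw [integral_pair hp hpg]; rfl

lemma measurable_blochOp_apply {Λ : Type*} [MeasurableSpace Λ] {g : Λ → E3} (hg : Measurable g)
    (j k : Fin 2) : Measurable fun l => blochOp (1, g l) j k :=
  ((Matrix.entryLinearMap ℝ ℂ j k) ∘ₗ blochOp).toContinuousLinearMap.measurable.comp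
    (measurable_const.prodMk hg)

end Bloch

section ProjectiveMeasurement

variable {n : ℕ} {P : Fin n → Op} {t : Fin n → ℝ} {m : Fin n → E3}

lemma IsProjectiveMeasurement.eq_zero_or_norm_eq_one
    (hP : IsProjectiveMeasurement fun i => blochOp (t i, m i)) (i : Fin n) :
    (m i = 0 ∧ (t i = 0 ∨ t i = 2)) ∨ (t i = 1 ∧ ‖m i‖ = 1) :=
  eq_zero_or_norm_eq_one_of_isIdempotentElem (hP.1 i).isIdempotentElem

lemma IsProjectiveMeasurement.norm_le
    (hP : IsProjectiveMeasurement fun i => blochOp (t i, m i)) (i : Fin n) : ‖m i‖ ≤ t i := by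
  rcases hP.eq_zero_or_norm_eq_one i with ⟨hm, ht | ht⟩ | ⟨ht, hm⟩ <;> simp [hm, ht]

lemma IsProjectiveMeasurement.sum_eq_two
    (hP : IsProjectiveMeasurement fun i => blochOp (t i, m i)) : ∑ i, t i = 2 := by
  have h_trace := congrArg Matrix.trace hP.2.2
  simp only [Matrix.trace_sum, trace_blochOp, Matrix.trace_one, Fintype.card_fin] at h_trace
  exact_mod_cast h_trace

lemma IsProjectiveMeasurement.inner_eq_neg_mul
    (hP : IsProjectiveMeasurement fun i => blochOp (t i, m i)) {i j : Fin n} (hij : i ≠ j) :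
    inner ℝ (m i) (m j) = -(t i * t j) := by
  have h_trace := congrArg Matrix.trace (hP.2.1 i j hij)
  rw [trace_blochOp_mul, Matrix.trace_zero, Complex.ofReal_eq_zero] at h_trace
  linarith

lemma IsProjectiveMeasurement.eq_zero_or_eq_neg
    (hP : IsProjectiveMeasurement fun i => blochOp (t i, m i)) {i j : Fin n} (hij : i ≠ j)
    (hi : t i = 1 ∧ ‖m i‖ = 1) : (t j = 0 ∧ m j = 0) ∨ (t j = 1 ∧ m j = -m i) := by
  have h_inner := hP.inner_eq_neg_mul hij
  rw [hi.1, one_mul] at h_inner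
  rcases hP.eq_zero_or_norm_eq_one j with ⟨hm, -⟩ | ⟨ht, hm⟩
  · rw [hm, inner_zero_right, zero_eq_neg] at h_inner
    exact .inl ⟨h_inner, hm⟩
  · refine .inr ⟨ht, ?_⟩
    rw [eq_neg_iff_add_eq_zero, add_comm, ← norm_eq_zero, ← sq_eq_zero_iff, norm_add_sq_real,
      hi.2, hm, h_inner, ht]
    norm_num

lemma IsProjectiveMeasurement.sum_odd_eq_zero
    (hP : IsProjectiveMeasurement fun i => blochOp (t i, m i)) {f : E3 → ℝ}
    (hf : ∀ v, f (-v) = -f v) : ∑ i, f (m i) = 0 := by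
  have hf0 : f 0 = 0 := by linarith [neg_zero (G := E3) ▸ hf 0]
  by_cases h : ∃ i, m i ≠ 0
  · obtain ⟨i, hmi⟩ := h
    have hi := (hP.eq_zero_or_norm_eq_one i).resolve_left fun h => hmi h.1
    have h_other : ∀ j ∈ Finset.univ.erase i, f (m j) = -f (m i) * t j := fun j hj => by
      rcases hP.eq_zero_or_eq_neg (Finset.ne_of_mem_erase hj).symm hi with
        ⟨ht, hm⟩ | ⟨ht, hm⟩ <;> simp [ht, hm, hf, hf0]
    have h_sum := hP.sum_eq_two
    rw [← Finset.add_sum_erase _ _ (Finset.mem_univ i), hi.1] at h_sum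
    rw [← Finset.add_sum_erase _ _ (Finset.mem_univ i), Finset.sum_congr rfl h_other,
      ← Finset.mul_sum]
    linear_combination -f (m i) * h_sum
  · push Not at h
    simp [h, hf0]

lemma IsProjectiveMeasurement.exists_blochOp (hP : IsProjectiveMeasurement P) :
    ∃ (t : Fin n → ℝ) (m : Fin n → E3), P = fun i => blochOp (t i, m i) := by
  choose t m h using fun i =>
    exists_blochOp_eq_of_isHermitian (P := P i) (hP.1 i).isSelfAdjoint.isHermitian
  exact ⟨t, m, funext fun i => (h i).symm⟩

end ProjectiveMeasurement

section LocalHiddenStates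

variable {Λ : Type} [MeasurableSpace Λ] {μ : Measure Λ} [IsProbabilityMeasure μ]
  {w : E3} {T : Matrix (Fin 3) (Fin 3) ℝ} {g : Λ → E3}

lemma conditionalState_blochState_eq_integral {t c : ℝ} {m : E3} {r : Λ → ℝ} (hg : Measurable g)
    (hg_norm : ∀ l, ‖g l‖ ≤ 1) (hg_mean : ∫ l, g l ∂μ = 0) (hr : Measurable r)
    (hr_abs : ∀ l, |r l| ≤ c) (hr_mean : ∫ l, r l ∂μ = inner ℝ w m)
    (hrg : ∫ l, r l • g l ∂μ = Matrix.toEuclideanLin Tᵀ m) (j k : Fin 2) :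
    conditionalState (blochState w T) (blochOp (t, m)) j k =
      ∫ l, (((t + r l) / 2 : ℝ) : ℂ) * blochOp (1, g l) j k ∂μ := by
  have h_int_g : Integrable g μ := .of_bound hg.aestronglyMeasurable 1 (.of_forall hg_norm)
  have h_int_tg : Integrable (fun l => t • g l) μ := h_int_g.smul t
  have h_int_r : Integrable r μ := .of_bound hr.aestronglyMeasurable c (.of_forall hr_abs)
  have h_int_p : Integrable (fun l => (t + r l) / 2) μ :=
    ((integrable_const t).add h_int_r).div_const 2
  have h_int_rg : Integrable (fun l => r l • g l) μ :=
    h_int_g.bdd_smul c hr.aestronglyMeasurable (.of_forall hr_abs)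
  have h_split (l : Λ) : ((t + r l) / 2) • g l = (1 / 2 : ℝ) • (t • g l + r l • g l) := by module
  have h_int : Integrable (fun l => ((t + r l) / 2) • g l) μ := by
    simp only [h_split]
    exact (h_int_tg.add h_int_rg).smul (1 / 2 : ℝ)
  have h_scalar : ∫ l, (t + r l) / 2 ∂μ = (1 / 2 : ℝ) • (t + inner ℝ w m) := by
    rw [integral_div, integral_add (integrable_const t) h_int_r, hr_mean, integral_const,
      probReal_univ, one_smul, smul_eq_mul, one_div_mul_eq_div]
  have h_vector : ∫ l, ((t + r l) / 2) • g l ∂μ =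
      (1 / 2 : ℝ) • Matrix.toEuclideanLin Tᵀ m := by
    simp only [h_split]
    rw [integral_smul, integral_add h_int_tg h_int_rg, integral_smul, hg_mean, smul_zero,
      zero_add, hrg]
  rw [integral_mul_blochOp h_int_p h_int, h_scalar, h_vector, ← Prod.smul_mk, map_smul,
    conditionalState_blochState]

lemma nonSteerable_of_bloch_model {R : E3 → Λ → ℝ} (hg : Measurable g)
    (hg_norm : ∀ l, ‖g l‖ ≤ 1) (hg_mean : ∫ l, g l ∂μ = 0) (hR : ∀ m, Measurable (R m))
    (hR_neg : ∀ m l, R (-m) l = -R m l) (hR_abs : ∀ m l, |R m l| ≤ ‖m‖)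
    (hR_mean : ∀ m, ∫ l, R m l ∂μ = inner ℝ w m)
    (hRg : ∀ m, ∫ l, R m l • g l ∂μ = Matrix.toEuclideanLin Tᵀ m) :
    NonSteerable (blochState w T) := by
  refine ⟨Λ, inferInstance, μ, fun l => blochOp (1, g l), inferInstance,
    measurable_blochOp_apply hg, fun l => isState_blochOp (hg_norm l), fun n P hP => ?_⟩
  obtain ⟨t, m, rfl⟩ := hP.exists_blochOp
  refine ⟨fun i l => (t i + R (m i) l) / 2, fun i => ((hR (m i)).const_add _).div_const 2,
    fun i l => ?_, fun l => ?_, fun i => conditionalState_blochState_eq_integral hg hg_norm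
      hg_mean (hR (m i)) (hR_abs (m i)) (hR_mean (m i)) (hRg (m i))⟩
  · linarith [neg_abs_le (R (m i) l), hR_abs (m i) l, hP.norm_le i]
  · rw [← Finset.sum_div, Finset.sum_add_distrib, hP.sum_eq_two,
      hP.sum_odd_eq_zero (f := fun v => R v l) fun v => hR_neg v l]
    norm_num

end LocalHiddenStates

section Hemispheres

open Metric

lemma measurable_coe_sign : Measurable fun r : ℝ => (SignType.sign r : ℝ) := by
  have h_div : (fun r : ℝ => (SignType.sign r : ℝ)) = fun r => r / |r| := by
    ext r
    rcases eq_or_ne r 0 with rfl | hr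
    · simp
    · rw [eq_div_iff (abs_ne_zero.mpr hr), sign_mul_abs]
  rw [h_div]
  fun_prop

lemma abs_coe_sign_le_one (r : ℝ) : |(SignType.sign r : ℝ)| ≤ 1 := by
  rcases lt_trichotomy r 0 with h | h | h <;> simp [h]

lemma coe_sign_neg (r : ℝ) : (SignType.sign (-r) : ℝ) = -(SignType.sign r : ℝ) := by
  rw [Left.sign_neg, SignType.coe_neg]

variable {F : Type*} [NormedAddCommGroup F] {f : E3 → F}

lemma integrable_toSphere_of_continuous (hf : Continuous f) :
    Integrable (fun x : sphere (0 : E3) 1 => f x) (volume : Measure E3).toSphere :=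
  (hf.comp continuous_subtype_val).integrable_of_hasCompactSupport
    (HasCompactSupport.of_compactSpace _)

variable [NormedSpace ℝ F]

lemma integrable_toSphere_sign_inner_smul (q : E3) (hf : Continuous f) :
    Integrable (fun x : sphere (0 : E3) 1 => (SignType.sign (inner ℝ q (x : E3)) : ℝ) • f x)
      (volume : Measure E3).toSphere :=
  (integrable_toSphere_of_continuous hf).bdd_smul 1
    (measurable_coe_sign.comp (by fun_prop)).aestronglyMeasurable
    (.of_forall fun _ => abs_coe_sign_le_one _)

lemma integral_sphere_abs_inner {e : E3} (he : ‖e‖ = 1) :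
    ∫ x : sphere (0 : E3) 1, |inner ℝ e (x : E3)| ∂(volume : Measure E3).toSphere =
      2 * Real.pi := by
  have h_neg : ∫ t in (-1 : ℝ)..0, |t| = 1 / 2 := by
    rw [intervalIntegral.integral_congr (g := fun t => -t) fun t ht => abs_of_nonpos ?_]
    · rw [intervalIntegral.integral_neg, integral_id]
      norm_num
    · exact (Set.uIcc_of_le (by norm_num : (-1 : ℝ) ≤ 0) ▸ ht).2
  have h_pos : ∫ t in (0 : ℝ)..1, |t| = 1 / 2 := by
    rw [intervalIntegral.integral_congr (g := fun t => t) fun t ht => abs_of_nonneg ?_]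
    · norm_num
    · exact (Set.uIcc_of_le (by norm_num : (0 : ℝ) ≤ 1) ▸ ht).1
  rw [integral_sphere_comp_inner he continuous_abs.measurable,
    ← intervalIntegral.integral_add_adjacent_intervals (b := 0)
      (continuous_abs.intervalIntegrable _ _) (continuous_abs.intervalIntegrable _ _), h_neg,
    h_pos]
  ring

lemma integral_sphere_sign_inner_smul {e : E3} (he : ‖e‖ = 1) :
    ∫ x : sphere (0 : E3) 1, (SignType.sign (inner ℝ e (x : E3)) : ℝ) • (x : E3)
      ∂(volume : Measure E3).toSphere = (2 * Real.pi) • e := by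
  -- the half-turn about `e` reverses the component orthogonal to `e`
  have h_orthogonal : ∫ x : sphere (0 : E3) 1, (SignType.sign (inner ℝ e (x : E3)) : ℝ) •
      ((x : E3) - inner ℝ e (x : E3) • e) ∂(volume : Measure E3).toSphere = 0 := by
    refine integral_sphere_eq_zero_of_comp_isometry_eq_neg (Submodule.reflection (ℝ ∙ e))
      (f := fun x => (SignType.sign (inner ℝ e x) : ℝ) • (x - inner ℝ e x • e)) fun x => ?_
    have h_refl : Submodule.reflection (ℝ ∙ e) x = (2 * inner ℝ e x) • e - x := by
      rw [Submodule.reflection_singleton_apply, he]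
      simp [two_smul, two_mul, add_smul]
    have h_inner : inner ℝ e (Submodule.reflection (ℝ ∙ e) x) = inner ℝ e x := by
      rw [h_refl, inner_sub_right, inner_smul_right, real_inner_self_eq_norm_sq, he]
      ring
    rw [h_inner, h_refl]
    module
  have h_split (x : E3) : (SignType.sign (inner ℝ e x) : ℝ) • x = |inner ℝ e x| • e +
      (SignType.sign (inner ℝ e x) : ℝ) • (x - inner ℝ e x • e) := by
    rw [← sign_mul_self]
    module
  simp only [h_split]
  rw [integral_add (integrable_toSphere_of_continuous (f := fun x => |inner ℝ e x| • e)
      (by fun_prop)) (integrable_toSphere_sign_inner_smul e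
      (f := fun x => x - inner ℝ e x • e) (by fun_prop)), h_orthogonal, add_zero,
    integral_smul_const, integral_sphere_abs_inner he]

lemma norm_smul_integral_sphere_sign_inner_smul (q : E3) :
    ‖q‖ • ∫ x : sphere (0 : E3) 1, (SignType.sign (inner ℝ q (x : E3)) : ℝ) • (x : E3)
      ∂(volume : Measure E3).toSphere = (2 * Real.pi) • q := by
  obtain ⟨e, he, hq⟩ := exists_norm_eq_one_and_eq_norm_smul q
  rcases eq_or_ne q 0 with rfl | hq0
  · simp
  have h_sign (x : E3) : SignType.sign (inner ℝ q x) = SignType.sign (inner ℝ e x) := by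
    rw [hq, real_inner_smul_left, sign_mul, sign_pos (norm_pos_iff.mpr hq0), one_mul]
  simp only [h_sign]
  rw [integral_sphere_sign_inner_smul he, smul_comm, ← hq]

end Hemispheres

section Ellipsoid

open Metric

/-- The measure on the unit sphere with density proportional to `‖L x‖`. The vectors
`L x / ‖L x‖` are the hidden Bloch vectors of the ellipsoid model. -/
def ellipsoidMeasure (L : E3 →L[ℝ] E3) : Measure (sphere (0 : E3) 1) :=
  (volume : Measure E3).toSphere.withDensity fun x =>
    ENNReal.ofReal (‖L x‖ / ∫ y : sphere (0 : E3) 1, ‖L y‖ ∂(volume : Measure E3).toSphere)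

variable {L : E3 →L[ℝ] E3}

lemma integral_ellipsoidMeasure {F : Type*} [NormedAddCommGroup F] [NormedSpace ℝ F]
    (f : sphere (0 : E3) 1 → F) :
    ∫ x, f x ∂ellipsoidMeasure L =
      (∫ y : sphere (0 : E3) 1, ‖L y‖ ∂(volume : Measure E3).toSphere)⁻¹ •
        ∫ x : sphere (0 : E3) 1, ‖L x‖ • f x ∂(volume : Measure E3).toSphere := by
  have h_mass : 0 ≤ ∫ y : sphere (0 : E3) 1, ‖L y‖ ∂(volume : Measure E3).toSphere :=
    integral_nonneg fun _ => norm_nonneg _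
  rw [ellipsoidMeasure, integral_withDensity_eq_integral_toReal_smul (by fun_prop)
    (.of_forall fun x => ENNReal.ofReal_lt_top), ← integral_smul]
  refine integral_congr_ae (.of_forall fun x => ?_)
  dsimp only
  rw [ENNReal.toReal_ofReal (div_nonneg (norm_nonneg _) h_mass), div_eq_inv_mul, mul_smul]

lemma norm_smul_smul_normalized (x : E3) (r : ℝ) : ‖L x‖ • r • ‖L x‖⁻¹ • L x = r • L x := by
  rcases eq_or_ne (L x) 0 with h | h
  · simp [h]
  · rw [smul_comm, smul_inv_smul₀ (norm_ne_zero_iff.mpr h)]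

lemma integral_ellipsoidMeasure_response_smul (b c : ℝ) (q : E3) :
    ∫ x, (b + c * SignType.sign (inner ℝ q (x : E3))) • (‖L x‖⁻¹ • L x) ∂ellipsoidMeasure L =
      ((∫ y : sphere (0 : E3) 1, ‖L y‖ ∂(volume : Measure E3).toSphere)⁻¹ * c) •
        L (∫ x : sphere (0 : E3) 1, (SignType.sign (inner ℝ q (x : E3)) : ℝ) • (x : E3)
          ∂(volume : Measure E3).toSphere) := by
  have h_int_sign : Integrable (fun x : sphere (0 : E3) 1 =>
      (SignType.sign (inner ℝ q (x : E3)) : ℝ) • (x : E3)) (volume : Measure E3).toSphere :=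
    integrable_toSphere_sign_inner_smul q continuous_id
  have h_int_sign_map : Integrable (fun x : sphere (0 : E3) 1 =>
      c • L ((SignType.sign (inner ℝ q (x : E3)) : ℝ) • (x : E3)))
      (volume : Measure E3).toSphere := (L.integrable_comp h_int_sign).smul c
  have h_int_map : Integrable (fun x : sphere (0 : E3) 1 => b • L x)
      (volume : Measure E3).toSphere :=
    (integrable_toSphere_of_continuous L.continuous).smul b
  have h_odd : ∫ x : sphere (0 : E3) 1, L x ∂(volume : Measure E3).toSphere = 0 :=
    integral_sphere_eq_zero_of_comp_isometry_eq_neg (LinearIsometryEquiv.neg ℝ) (f := L) (by simp)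
  have h_split (x : E3) : ‖L x‖ • (b + c * SignType.sign (inner ℝ q x)) • (‖L x‖⁻¹ • L x) =
      b • L x + c • L ((SignType.sign (inner ℝ q x) : ℝ) • x) := by
    rw [norm_smul_smul_normalized, map_smul, add_smul, mul_smul]
  rw [integral_ellipsoidMeasure]
  simp only [h_split]
  rw [integral_add h_int_map h_int_sign_map, integral_smul, integral_smul, h_odd, smul_zero,
    zero_add, L.integral_comp_comm h_int_sign, mul_smul]

variable (hL : 0 < ∫ y : sphere (0 : E3) 1, ‖L y‖ ∂(volume : Measure E3).toSphere)
include hL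

lemma isProbabilityMeasure_ellipsoidMeasure : IsProbabilityMeasure (ellipsoidMeasure L) := by
  constructor
  rw [ellipsoidMeasure, withDensity_apply _ .univ, Measure.restrict_univ,
    ← ofReal_integral_eq_lintegral_ofReal, integral_div, div_self hL.ne', ENNReal.ofReal_one]
  · exact (integrable_toSphere_of_continuous (f := fun x => ‖L x‖) (by fun_prop)).div_const _
  · exact .of_forall fun x => div_nonneg (norm_nonneg _) hL.le

lemma integral_ellipsoidMeasure_response (b c : ℝ) (q : E3) :
    ∫ x, (b + c * SignType.sign (inner ℝ q (x : E3))) ∂ellipsoidMeasure L = b := by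
  have h_sign : ∫ x : sphere (0 : E3) 1, (SignType.sign (inner ℝ q (x : E3)) : ℝ) • ‖L x‖
      ∂(volume : Measure E3).toSphere = 0 :=
    integral_sphere_eq_zero_of_comp_isometry_eq_neg (LinearIsometryEquiv.neg ℝ)
      (f := fun x => (SignType.sign (inner ℝ q x) : ℝ) • ‖L x‖) fun x => by
        simp [coe_sign_neg]
  have h_split (x : E3) : ‖L x‖ • (b + c * SignType.sign (inner ℝ q x)) =
      b • ‖L x‖ + c • ((SignType.sign (inner ℝ q x) : ℝ) • ‖L x‖) := by
    simp only [smul_eq_mul]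
    ring
  have h_int_norm : Integrable (fun x : sphere (0 : E3) 1 => b • ‖L x‖)
      (volume : Measure E3).toSphere :=
    (integrable_toSphere_of_continuous (f := fun x => ‖L x‖) (by fun_prop)).smul b
  have h_int_sign : Integrable (fun x : sphere (0 : E3) 1 =>
      c • ((SignType.sign (inner ℝ q (x : E3)) : ℝ) • ‖L x‖)) (volume : Measure E3).toSphere :=
    (integrable_toSphere_sign_inner_smul q (f := fun x => ‖L x‖) (by fun_prop)).smul c
  rw [integral_ellipsoidMeasure]
  simp only [h_split]
  rw [integral_add h_int_norm h_int_sign, integral_smul, integral_smul, h_sign, smul_zero,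
    add_zero, smul_comm, smul_eq_mul, smul_eq_mul, inv_mul_cancel₀ hL.ne', mul_one]

theorem nonSteerable_of_ellipsoid {w : E3} {T : Matrix (Fin 3) (Fin 3) ℝ} (Q : E3 →ₗ[ℝ] E3)
    (hLQ : ∀ m, L (Q m) = Matrix.toEuclideanLin Tᵀ m)
    (hQ : ∀ m, |inner ℝ w m| + 1 / (2 * Real.pi) *
      (∫ y : sphere (0 : E3) 1, ‖L y‖ ∂(volume : Measure E3).toSphere) * ‖Q m‖ ≤ ‖m‖) :
    NonSteerable (blochState w T) := by
  have := isProbabilityMeasure_ellipsoidMeasure hL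
  set N := ∫ y : sphere (0 : E3) 1, ‖L y‖ ∂(volume : Measure E3).toSphere with hN
  have h_radius (m : E3) : 0 ≤ 1 / (2 * Real.pi) * N * ‖Q m‖ := by positivity
  refine nonSteerable_of_bloch_model (μ := ellipsoidMeasure L) (g := fun x => ‖L x‖⁻¹ • L x)
    (R := fun m x => inner ℝ w m +
      1 / (2 * Real.pi) * N * ‖Q m‖ * SignType.sign (inner ℝ (Q m) (x : E3)))
    (by fun_prop) (fun x => ?_) ?_ (fun m => ?_) (fun m x => ?_) (fun m x => ?_) (fun m => ?_)
    fun m => ?_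
  · rw [norm_smul, norm_inv, norm_norm]
    exact inv_mul_le_one
  · simpa using integral_ellipsoidMeasure_response_smul (L := L) 1 0 0
  · exact ((measurable_coe_sign.comp (by fun_prop)).const_mul _).const_add _
  · rw [map_neg, inner_neg_right, inner_neg_left, norm_neg, coe_sign_neg]
    ring
  · refine (abs_add_le _ _).trans ((add_le_add_right ?_ _).trans (hQ m))
    rw [abs_mul, abs_of_nonneg (h_radius m)]
    exact mul_le_of_le_one_right (h_radius m) (abs_coe_sign_le_one _)
  · exact integral_ellipsoidMeasure_response hL _ _ _
  · have h_scale : N⁻¹ * (1 / (2 * Real.pi) * N * ‖Q m‖) = (1 / (2 * Real.pi)) * ‖Q m‖ := by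
      field_simp
    rw [integral_ellipsoidMeasure_response_smul, ← hN, h_scale, mul_smul, ← map_smul,
      norm_smul_integral_sphere_sign_inner_smul, map_smul, smul_smul,
      one_div_mul_cancel (by positivity), one_smul, hLQ]

end Ellipsoid

section BorderIntegral

open Metric

lemma integral_sqrt_one_add_sq {k : ℝ} (hk : k ≠ 0) :
    ∫ z in (-1 : ℝ)..1, √(1 + (k * z) ^ 2) = √(1 + k ^ 2) + k⁻¹ * Real.arsinh k := by
  have h_deriv (z : ℝ) : HasDerivAt
      (fun z => (z * √(1 + (k * z) ^ 2) + k⁻¹ * Real.arsinh (k * z)) / 2)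
      √(1 + (k * z) ^ 2) z := by
    have h_pos : 0 < 1 + (k * z) ^ 2 := by positivity
    have h_linear : HasDerivAt (fun z : ℝ => k * z) k z := by
      simpa using (hasDerivAt_id z).const_mul k
    have h_sqrt := ((h_linear.pow 2).const_add 1).sqrt h_pos.ne'
    refine ((((hasDerivAt_id z).mul h_sqrt).add
      (h_linear.arsinh.const_mul k⁻¹)).div_const 2).congr_deriv ?_
    have h_ne : √(1 + (k * z) ^ 2) ≠ 0 := (Real.sqrt_pos.mpr h_pos).ne'
    have h_sq := Real.sq_sqrt h_pos.le
    simp only [id, Pi.pow_apply, smul_eq_mul, Nat.cast_ofNat, Nat.add_one_sub_one, pow_one]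
    generalize √(1 + (k * z) ^ 2) = r at h_ne h_sq ⊢
    field_simp
    rw [h_sq]
    ring
  rw [intervalIntegral.integral_eq_sub_of_hasDerivAt (fun z _ => h_deriv z)
    ((by fun_prop : Continuous _).intervalIntegrable _ _)]
  simp only [mul_one, mul_neg, neg_sq, Real.arsinh_neg]
  ring

lemma bracket_eq_integral {a : ℝ} (ha0 : 0 < a) (ha1 : a < 1) :
    bracket a = ∫ z in (-1 : ℝ)..1, √(1 + a / (1 - a) * z ^ 2) := by
  have h_pos : 0 < 1 - a := sub_pos.mpr ha1
  have h_ratio : 0 < a / (1 - a) := by positivity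
  have h_sq (z : ℝ) : a / (1 - a) * z ^ 2 = (√(a / (1 - a)) * z) ^ 2 := by
    rw [mul_pow, Real.sq_sqrt h_ratio.le]
  have h_one_add : 1 + a / (1 - a) = (1 - a)⁻¹ := by
    field_simp
    ring
  simp only [h_sq]
  rw [integral_sqrt_one_add_sq (Real.sqrt_pos.mpr h_ratio).ne', Real.sq_sqrt h_ratio.le,
    h_one_add, bracket, ← Real.sqrt_inv, inv_div, one_div, ← Real.sqrt_inv]

lemma two_le_bracket {a : ℝ} (ha0 : 0 < a) (ha1 : a < 1) : 2 ≤ bracket a := by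
  have h_pos : 0 < 1 - a := sub_pos.mpr ha1
  calc (2 : ℝ) = ∫ _z in (-1 : ℝ)..1, (1 : ℝ) := by norm_num
    _ ≤ ∫ z in (-1 : ℝ)..1, √(1 + a / (1 - a) * z ^ 2) :=
      intervalIntegral.integral_mono_on (by norm_num) (by simp)
        ((by fun_prop : Continuous _).intervalIntegrable _ _) fun z _ =>
          Real.one_le_sqrt.mpr <| le_add_of_nonneg_right <|
            mul_nonneg (div_nonneg ha0.le h_pos.le) (sq_nonneg z)
    _ = bracket a := (bracket_eq_integral ha0 ha1).symm

lemma one_div_sqrt_le_bracket (a : ℝ) : 1 / √(1 - a) ≤ bracket a :=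
  le_add_of_nonneg_right <| mul_nonneg (Real.sqrt_nonneg _) <|
    Real.arsinh_nonneg_iff.mpr (Real.sqrt_nonneg _)

/-- For a unit vector `e`, the linear map that multiplies the axis `ℝ e` by `β` and its orthogonal
complement by `α`. -/
def axialStretch (e : E3) (α β : ℝ) : E3 →L[ℝ] E3 :=
  α • .id ℝ E3 + (β - α) • (innerSL ℝ e).smulRight e

lemma axialStretch_apply (e : E3) (α β : ℝ) (x : E3) :
    axialStretch e α β x = α • x + ((β - α) * inner ℝ e x) • e := by
  simp [axialStretch, mul_smul]

variable {e : E3} (he : ‖e‖ = 1)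
include he

lemma axialStretch_axialStretch (α β α' β' : ℝ) (x : E3) :
    axialStretch e α β (axialStretch e α' β' x) = axialStretch e (α * α') (β * β') x := by
  simp only [axialStretch_apply, inner_add_right, inner_smul_right, real_inner_self_eq_norm_sq, he]
  module

lemma norm_axialStretch_sq (α β : ℝ) (x : E3) :
    ‖axialStretch e α β x‖ ^ 2 =
      α ^ 2 * (‖x‖ ^ 2 - inner ℝ e x ^ 2) + β ^ 2 * inner ℝ e x ^ 2 := by
  rw [axialStretch_apply, norm_add_sq_real, norm_smul, norm_smul, real_inner_smul_left,
    real_inner_smul_right, real_inner_comm, he, mul_pow, Real.norm_eq_abs, sq_abs, mul_one,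
    Real.norm_eq_abs, sq_abs]
  ring

lemma integral_sphere_norm_axialStretch {a α β : ℝ} (ha0 : 0 < a) (ha1 : a < 1)
    (h : β ^ 2 * (1 - a) = α ^ 2) :
    ∫ x : sphere (0 : E3) 1, ‖axialStretch e α β x‖ ∂(volume : Measure E3).toSphere =
      2 * Real.pi * (|α| * bracket a) := by
  have h_norm (x : sphere (0 : E3) 1) :
      ‖axialStretch e α β x‖ = |α| * √(1 + a / (1 - a) * inner ℝ e (x : E3) ^ 2) := by
    have h_pos : 0 < 1 - a := sub_pos.mpr ha1
    have h_beta : β ^ 2 = α ^ 2 / (1 - a) := by rw [← h, mul_div_cancel_right₀ _ h_pos.ne']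
    rw [← Real.sqrt_sq (norm_nonneg (axialStretch e α β x)), norm_axialStretch_sq he,
      norm_eq_of_mem_sphere, h_beta, ← Real.sqrt_sq_eq_abs, ← Real.sqrt_mul (sq_nonneg α)]
    congr 1
    field_simp
    ring
  simp only [h_norm]
  rw [integral_const_mul, integral_sphere_comp_inner he
    (f := fun z => √(1 + a / (1 - a) * z ^ 2)) (by fun_prop), bracket_eq_integral ha0 ha1]
  ring

omit he

lemma borderIntegral_eq_integral_norm {T : Matrix (Fin 3) (Fin 3) ℝ} (hT : T.IsSymm) :
    borderIntegral T = 1 / (2 * Real.pi) * ∫ x : sphere (0 : E3) 1,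
      ‖Matrix.toEuclideanLin T (x : E3)‖ ∂(volume : Measure E3).toSphere := by
  have h_quadratic (x : E3) : x.ofLp ⬝ᵥ ((T ^ 2) *ᵥ x.ofLp) = ‖Matrix.toEuclideanLin T x‖ ^ 2 := by
    rw [← real_inner_self_eq_norm_sq, EuclideanSpace.inner_eq_star_dotProduct, star_trivial,
      Matrix.ofLp_toLpLin, Matrix.toLin'_apply, sq, ← Matrix.mulVec_mulVec,
      Matrix.dotProduct_mulVec, ← Matrix.mulVec_transpose, hT.eq]
  simp only [borderIntegral, h_quadratic, Real.sqrt_sq (norm_nonneg _)]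

lemma toEuclideanLin_diagonal_eq_axialStretch (x z : ℝ) (v : E3) :
    Matrix.toEuclideanLin (Matrix.diagonal ![x, x, z]) v = axialStretch ez x z v := by
  ext i
  fin_cases i <;> simp [axialStretch_apply, ez, Matrix.mulVec_diagonal, inner_eq_sum]
  ring

lemma borderIntegral_diagonal {a x z : ℝ} (ha0 : 0 < a) (ha1 : a < 1)
    (h : z ^ 2 * (1 - a) = x ^ 2) :
    borderIntegral (Matrix.diagonal ![x, x, z]) = |x| * bracket a := by
  rw [borderIntegral_eq_integral_norm (Matrix.isSymm_diagonal _)]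
  simp only [toEuclideanLin_diagonal_eq_axialStretch]
  rw [integral_sphere_norm_axialStretch (by simp [ez]) ha0 ha1 h, ← mul_assoc,
    one_div_mul_cancel (by positivity), one_mul]

end BorderIntegral

section PositiveCorrelation

variable {e : E3} {a ξ : ℝ}

lemma mul_abs_inner_add_norm_axialStretch_le (he : ‖e‖ = 1) (ha0 : 0 ≤ a) (ha1 : a ≤ 1) (m : E3) :
    a * |inner ℝ e m| + ‖axialStretch e √(1 - a) (1 - a) m‖ ≤ ‖m‖ := by
  have h_inner : |inner ℝ e m| ≤ ‖m‖ := by simpa [he] using abs_real_inner_le_norm e m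
  have h_slack : 0 ≤ ‖m‖ - a * |inner ℝ e m| := by
    nlinarith [abs_nonneg (inner ℝ e m)]
  have h_sq : ‖axialStretch e √(1 - a) (1 - a) m‖ ^ 2 ≤ (‖m‖ - a * |inner ℝ e m|) ^ 2 := by
    rw [norm_axialStretch_sq he, Real.sq_sqrt (by linarith), ← sq_abs (inner ℝ e m)]
    nlinarith [mul_nonneg ha0 (sq_nonneg (‖m‖ - |inner ℝ e m|))]
  linarith [le_of_sq_le_sq h_sq h_slack]

lemma nonSteerable_displacedWerner_of_pos {w : E3} (ha0 : 0 < a) (ha1 : a < 1) (hw : ‖w‖ = a)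
    (hξ0 : 0 < ξ) (hξ : ξ ≤ √(1 - a) * (bracket a)⁻¹) :
    NonSteerable (displacedWerner w ξ) := by
  obtain ⟨e, he, hwe⟩ := exists_norm_eq_one_and_eq_norm_smul w
  rw [hw] at hwe
  set c := √(1 - a)
  have hc0 : 0 < c := Real.sqrt_pos.mpr (sub_pos.mpr ha1)
  have hc_sq : c ^ 2 = 1 - a := Real.sq_sqrt (sub_pos.mpr ha1).le
  have hB : 0 < bracket a := two_pos.trans_le (two_le_bracket ha0 ha1)
  have h_integral := integral_sphere_norm_axialStretch he (α := -ξ / c) (β := -ξ / c ^ 2) ha0 ha1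
    (by rw [← hc_sq]; field_simp)
  have h_alpha : |-ξ / c| = ξ / c := by rw [neg_div, abs_neg, abs_of_pos (by positivity)]
  rw [h_alpha] at h_integral
  have h_radius : ξ / c * bracket a ≤ 1 := by
    rwa [div_mul_eq_mul_div, div_le_one hc0, ← le_div_iff₀ hB]
  refine nonSteerable_of_ellipsoid (L := axialStretch e (-ξ / c) (-ξ / c ^ 2))
    (by rw [h_integral]; positivity) (axialStretch e c (1 - a)) (fun m => ?_) fun m => ?_
  · rw [ContinuousLinearMap.coe_coe, axialStretch_axialStretch he, ← hc_sq,
      div_mul_cancel₀ _ hc0.ne', div_mul_cancel₀ _ (pow_ne_zero 2 hc0.ne'), axialStretch_apply]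
    simp
  · calc |inner ℝ w m| + _ = a * |inner ℝ e m| +
          ξ / c * bracket a * ‖axialStretch e c (1 - a) m‖ := by
          rw [h_integral, hwe, real_inner_smul_left, abs_mul, abs_of_pos ha0,
            ContinuousLinearMap.coe_coe]
          field_simp
      _ ≤ a * |inner ℝ e m| + ‖axialStretch e c (1 - a) m‖ := by
          gcongr
          exact mul_le_of_le_one_left (norm_nonneg _) h_radius
      _ ≤ ‖m‖ := mul_abs_inner_add_norm_axialStretch_le he ha0.le ha1.le m

end PositiveCorrelation

section SeparableStates

variable {ι : Type} [Fintype ι] {w : E3} {T : Matrix (Fin 3) (Fin 3) ℝ} {p : ι → ℝ}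

lemma nonSteerable_of_product_mixture {α β : ι → E3} (hp : p ∈ stdSimplex ℝ ι)
    (hα : ∀ k, ‖α k‖ ≤ 1) (hβ : ∀ k, ‖β k‖ ≤ 1) (hα_mean : ∑ k, p k • α k = w)
    (hβ_mean : ∑ k, p k • β k = 0)
    (hT : ∀ m, ∑ k, (p k * inner ℝ (α k) m) • β k = Matrix.toEuclideanLin Tᵀ m) :
    NonSteerable (blochState w T) := by
  let _ : MeasurableSpace ι := ⊤
  let π : PMF ι := PMF.ofFintype (fun k => ENNReal.ofReal (p k)) <| by
    rw [← ENNReal.ofReal_sum_of_nonneg fun k _ => hp.1 k, hp.2, ENNReal.ofReal_one]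
  have h_integral {F : Type} [NormedAddCommGroup F] [NormedSpace ℝ F] [CompleteSpace F]
      (f : ι → F) : ∫ k, f k ∂π.toMeasure = ∑ k, p k • f k := by
    rw [PMF.integral_eq_sum]
    exact Finset.sum_congr rfl fun k _ => by
      rw [PMF.ofFintype_apply, ENNReal.toReal_ofReal (hp.1 k)]
  refine nonSteerable_of_bloch_model (μ := π.toMeasure) (R := fun m k => inner ℝ (α k) m)
    (measurable_of_finite β) hβ (by rw [h_integral, hβ_mean]) (fun m => measurable_of_finite _)
    (fun m k => inner_neg_right _ _) (fun m k => ?_) (fun m => ?_) fun m => ?_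
  · exact (abs_real_inner_le_norm _ _).trans (mul_le_of_le_one_left (norm_nonneg m) (hα k))
  · simp only [h_integral, ← hα_mean, sum_inner, real_inner_smul_left, smul_eq_mul]
  · simp only [h_integral, ← hT, mul_smul]

lemma nonSteerable_of_antipodal_mixture {α β b : ι → E3} (hp : p ∈ stdSimplex ℝ ι)
    (h_add : ∀ k, ‖α k + β k‖ ≤ 1) (h_sub : ∀ k, ‖α k - β k‖ ≤ 1) (hb : ∀ k, ‖b k‖ ≤ 1)
    (hα : ∑ k, p k • α k = w)
    (hβ : ∀ m, ∑ k, (p k * inner ℝ (β k) m) • b k = Matrix.toEuclideanLin Tᵀ m) :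
    NonSteerable (blochState w T) := by
  refine nonSteerable_of_product_mixture (p := fun l : ι × Bool => p l.1 / 2)
    (α := fun l => bif l.2 then α l.1 + β l.1 else α l.1 - β l.1)
    (β := fun l => bif l.2 then b l.1 else -b l.1)
    ⟨fun l => div_nonneg (hp.1 l.1) two_pos.le, ?_⟩ ?_ ?_ ?_ ?_ fun m => ?_
  · simp only [Fintype.sum_prod_type, Fintype.sum_bool, add_halves, hp.2]
  · rintro ⟨k, _ | _⟩
    exacts [h_sub k, h_add k]
  · rintro ⟨k, _ | _⟩
    exacts [(norm_neg (b k)).trans_le (hb k), hb k]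
  · simp only [Fintype.sum_prod_type, Fintype.sum_bool, ← hα, cond_true, cond_false]
    exact Finset.sum_congr rfl fun k _ => by module
  · simp [Fintype.sum_prod_type]
  · simp only [Fintype.sum_prod_type, Fintype.sum_bool, ← hβ, cond_true, cond_false,
      inner_add_left, inner_sub_left]
    exact Finset.sum_congr rfl fun k _ => by module

end SeparableStates

section NegativeCorrelation

variable {w e : E3} {a ξ : ℝ}

lemma IsState.displacedWerner_quadratic_nonneg (h : IsState (displacedWerner (a • e) ξ))
    (he : ‖e‖ = 1) (x y : ℝ) :
    0 ≤ (1 + 3 * ξ) * x ^ 2 + 2 * a * x * y + (1 - ξ) * y ^ 2 := by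
  -- `x ψ + y (e·σ ⊗ 1) ψ` for the singlet `ψ`
  let v : Fin 2 × Fin 2 → ℂ := fun r =>
    !![-(y * (e 0 - e 1 * Complex.I)), x + y * e 2;
      -(x - y * e 2), y * (e 0 + e 1 * Complex.I)] r.1 r.2
  have h_expectation : (star v ⬝ᵥ (displacedWerner (a • e) ξ *ᵥ v)).re =
      ((1 + 3 * ξ) * x ^ 2 + 2 * a * x * y + (1 - ξ) * y ^ 2) / 2 := by
    have he_sq := norm_sq_eq_sum e
    rw [he] at he_sq
    simp [v, displacedWerner, blochState, pauli, Fin.sum_univ_succ, Matrix.one_apply, dotProduct,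
      Matrix.mulVec, Fintype.sum_prod_type]
    linear_combination (-(a * x * y) - (1 - ξ) * y ^ 2 / 2) * he_sq
  have h_nonneg := (Complex.le_def.mp (h.1.dotProduct_mulVec_nonneg v)).1
  rw [h_expectation, Complex.zero_re] at h_nonneg
  linarith

lemma IsState.displacedWerner_bound (h : IsState (displacedWerner w ξ)) :
    0 ≤ 1 + 3 * ξ ∧ ‖w‖ ^ 2 ≤ (1 + 3 * ξ) * (1 - ξ) := by
  obtain ⟨e, he, hw⟩ := exists_norm_eq_one_and_eq_norm_smul w
  rw [hw] at h
  have h_form := h.displacedWerner_quadratic_nonneg he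
  have h_discrim : discrim (1 + 3 * ξ) (2 * ‖w‖) (1 - ξ) ≤ 0 :=
    discrim_le_zero fun x => by linarith [h_form x 1]
  rw [discrim] at h_discrim
  constructor <;> linarith [h_form 1 0]

lemma norm_smul_add_smul_sq_of_orthonormal {ι : Type*} {b : ι → E3} (hb : Orthonormal ℝ b)
    {i j : ι} (hij : i ≠ j) (r s : ℝ) : ‖r • b i + s • b j‖ ^ 2 = r ^ 2 + s ^ 2 := by
  rw [norm_add_sq_real, norm_smul, norm_smul, real_inner_smul_left, real_inner_smul_right,
    hb.2 hij, hb.1, hb.1, Real.norm_eq_abs, Real.norm_eq_abs, mul_one, mul_one, sq_abs, sq_abs]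
  ring

lemma nonSteerable_displacedWerner_of_nonpos (hξ : ξ ≤ 0) (h : IsState (displacedWerner w ξ)) :
    NonSteerable (displacedWerner w ξ) := by
  obtain ⟨h_pos, h_bound⟩ := h.displacedWerner_bound
  obtain ⟨e, he, hw⟩ := exists_norm_eq_one_and_eq_norm_smul w
  obtain ⟨b, rfl⟩ := exists_orthonormalBasis_apply_zero_eq he
  have hη : 0 < 1 + ξ := by linarith
  set r := ‖w‖ / (1 + ξ) with hr
  set q := -2 * ξ / (1 + ξ) with hq
  have h_norm {s : ℝ} (hs : s ^ 2 = q ^ 2) {k : Fin 3} (hk : 0 ≠ k) :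
      ‖r • b 0 + s • b k‖ ≤ 1 := by
    rw [← sq_le_one_iff₀ (norm_nonneg _), norm_smul_add_smul_sq_of_orthonormal b.orthonormal hk,
      hs, hr, hq, div_pow, div_pow, ← add_div, div_le_one (by positivity)]
    linarith
  have h_sub {k : Fin 3} (hk : 0 ≠ k) : ‖r • b 0 - q • b k‖ ≤ 1 := by
    rw [sub_eq_add_neg, ← neg_smul]
    exact h_norm (neg_sq q) hk
  refine nonSteerable_of_antipodal_mixture (p := ![-ξ, (1 + ξ) / 2, (1 + ξ) / 2])
    (α := ![0, r • b 0, r • b 0]) (β := ![b 0, q • b 1, q • b 2]) (b := b) ⟨?_, ?_⟩ ?_ ?_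
    (fun k => (b.norm_eq_one k).le) ?_ fun m => ?_
  · simpa [Fin.forall_fin_succ] using ⟨hξ, (half_pos hη).le⟩
  · simp only [Fin.sum_univ_three, Matrix.cons_val]
    ring
  · simpa [Fin.forall_fin_succ] using ⟨h_norm rfl (by decide), h_norm rfl (by decide)⟩
  · simpa [Fin.forall_fin_succ] using ⟨h_sub (by decide), h_sub (by decide)⟩
  · have h_weight : (1 + ξ) / 2 * r + (1 + ξ) / 2 * r = ‖w‖ := by
      rw [hr]
      field_simp
      ring
    conv_rhs => rw [hw]
    simp only [Fin.sum_univ_three, Matrix.cons_val]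
    linear_combination (norm := module) h_weight • b 0
  · have h_weight : (1 + ξ) / 2 * q = -ξ := by
      rw [hq]
      field_simp
    have h_correlation : Matrix.toEuclideanLin (-(ξ • 1))ᵀ m = -ξ • m := by simp
    rw [h_correlation]
    conv_rhs => rw [← b.sum_repr' m]
    simp only [Fin.sum_univ_three, Matrix.cons_val, real_inner_smul_left]
    linear_combination (norm := module)
      (inner ℝ (b 1) m * h_weight) • b 1 + (inner ℝ (b 2) m * h_weight) • b 2

theorem nonSteerable_displacedWerner (ha0 : 0 < a) (ha1 : a < 1) (hw : ‖w‖ = a)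
    (h : IsState (displacedWerner w ξ)) (hξ : ξ ≤ √(1 - a) * (bracket a)⁻¹) :
    NonSteerable (displacedWerner w ξ) := by
  rcases le_or_gt ξ 0 with hξ0 | hξ0
  · exact nonSteerable_displacedWerner_of_nonpos hξ0 h
  · exact nonSteerable_displacedWerner_of_pos ha0 ha1 hw hξ0 hξ

end NegativeCorrelation

section Kraus

lemma mul_single_mul_conjTranspose_apply {m n : Type*} [Fintype n] [DecidableEq n]
    (A : Matrix m n ℂ) (i j : n) (r s : m) :
    (A * Matrix.single i j (1 : ℂ) * Aᴴ) r s = A r i * star (A s j) := by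
  rw [Matrix.single_eq_single_vecMulVec_single, Matrix.mul_vecMulVec, Matrix.vecMulVec_mul,
    Matrix.vecMulVec_apply, Matrix.mulVec_single_one, Matrix.single_one_vecMul]
  rfl

variable {n κ κ' : Type*} [Fintype n] [DecidableEq n] [Fintype κ]

/-- The completely positive map `X ↦ ∑ₖ Kₖ X Kₖᴴ` with Kraus operators `K`. -/
def krausMap (K : κ → Matrix n n ℂ) : Matrix n n ℂ →ₗ[ℂ] Matrix n n ℂ :=
  ∑ k, LinearMap.mulLeftRight ℂ (K k, (K k)ᴴ)

lemma krausMap_apply (K : κ → Matrix n n ℂ) (X : Matrix n n ℂ) :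
    krausMap K X = ∑ k, K k * X * (K k)ᴴ := by
  simp [krausMap]

lemma trace_krausMap (K : κ → Matrix n n ℂ) (X : Matrix n n ℂ) :
    (krausMap K X).trace = ((∑ k, (K k)ᴴ * K k) * X).trace := by
  simp_rw [krausMap_apply, Finset.sum_mul, Matrix.trace_sum]
  exact Finset.sum_congr rfl fun k _ => Matrix.trace_mul_cycle _ _ _

lemma sum_trace_mul_star_trace (K : κ → Matrix n n ℂ) (Y : Matrix n n ℂ) :
    ∑ k, (Y * K k).trace * star (Y * K k).trace =
      ∑ i, ∑ j, (Y * krausMap K (Matrix.single i j 1) * Yᴴ : Matrix n n ℂ) i j := by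
  have h (k : κ) (i j : n) : (Y * (K k * Matrix.single i j 1 * (K k)ᴴ) * Yᴴ : Matrix n n ℂ) i j =
      (Y * K k) i i * star ((Y * K k) j j) := by
    simp_rw [← mul_single_mul_conjTranspose_apply, Matrix.conjTranspose_mul, mul_assoc]
  simp_rw [krausMap_apply, Finset.mul_sum, Finset.sum_mul, Matrix.sum_apply, h]
  simp_rw [Matrix.trace, Matrix.diag, star_sum, Finset.sum_mul_sum]
  rw [Finset.sum_comm]
  exact Finset.sum_congr rfl fun i _ => Finset.sum_comm

variable [Fintype κ']

lemma mem_span_range_of_krausMap_eq_add {ι : Type*} [Fintype ι] {K : ι → Matrix n n ℂ}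
    {L : κ → Matrix n n ℂ} {L' : κ' → Matrix n n ℂ} {p q : ℝ} (hp : 0 < p) (hq : 0 ≤ q)
    (h : krausMap K = p • krausMap L + q • krausMap L') (m : κ) :
    L m ∈ Submodule.span ℂ (Set.range K) := by
  have hker (Y : Matrix n n ℂ) (hY : ∀ k, (Y * K k).trace = 0) : (Y * L m).trace = 0 := by
    have hsum : p * ∑ k, ‖(Y * L k).trace‖ ^ 2 + q * ∑ k, ‖(Y * L' k).trace‖ ^ 2 = 0 := by
      have hK := sum_trace_mul_star_trace K Y
      simp only [h, hY, zero_mul, Finset.sum_const_zero, LinearMap.add_apply, LinearMap.smul_apply,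
        mul_add, add_mul, Matrix.add_apply, Finset.sum_add_distrib, mul_smul_comm, smul_mul_assoc,
        Matrix.smul_apply, ← Finset.smul_sum, ← sum_trace_mul_star_trace] at hK
      simp only [RCLike.star_def, Complex.mul_conj', Complex.real_smul] at hK
      exact_mod_cast hK.symm
    have hL := (add_eq_zero_iff_of_nonneg (by positivity) (by positivity)).mp hsum
    have hLm := (Finset.sum_eq_zero_iff_of_nonneg fun k _ => by positivity).mp
      ((mul_eq_zero_iff_left hp.ne').mp hL.1) m (Finset.mem_univ m)
    simpa using hLm
  have := mem_span_of_iInf_ker_le_ker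
    (L := fun k => Matrix.traceLinearMap n ℂ ℂ ∘ₗ LinearMap.mulRight ℂ (K k))
    (K := Matrix.traceLinearMap n ℂ ℂ ∘ₗ LinearMap.mulRight ℂ (L m)) fun Y hY =>
      hker Y fun k => by simpa using (Submodule.mem_iInf _).mp hY k
  obtain ⟨c, hc⟩ := (Submodule.mem_span_range_iff_exists_fun ℂ).mp this
  refine (Submodule.mem_span_range_iff_exists_fun ℂ).mpr
    ⟨c, Matrix.ext_iff_trace_mul_left.mpr fun Y => ?_⟩
  simpa [Finset.mul_sum, Matrix.trace_sum] using LinearMap.congr_fun hc Y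

lemma krausMap_eq_of_mem_span_range {K : κ → Matrix n n ℂ} {L : κ' → Matrix n n ℂ}
    (hL : ∀ m, L m ∈ Submodule.span ℂ (Set.range K))
    (hK : LinearIndependent ℂ fun kl : κ × κ => (K kl.1)ᴴ * K kl.2)
    (h : ∑ m, (L m)ᴴ * L m = ∑ k, (K k)ᴴ * K k) : krausMap L = krausMap K := by
  classical
  choose c hc using fun m => (Submodule.mem_span_range_iff_exists_fun ℂ).mp (hL m)
  have hunitary (k l : κ) : ∑ m, star (c m k) * c m l = if k = l then 1 else 0 := by
    have : ∑ kl : κ × κ, (∑ m, star (c m kl.1) * c m kl.2 - if kl.1 = kl.2 then 1 else 0) •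
        ((K kl.1)ᴴ * K kl.2) = 0 := by
      simp_rw [sub_smul, Finset.sum_sub_distrib, Fintype.sum_prod_type, ite_smul, one_smul,
        zero_smul, Finset.sum_ite_eq, Finset.mem_univ, if_true, ← h, ← hc,
        Matrix.conjTranspose_sum, Finset.sum_mul, Finset.mul_sum, Matrix.conjTranspose_smul,
        smul_mul_assoc, mul_smul_comm, smul_smul, Finset.sum_smul]
      rw [sub_eq_zero, eq_comm, Finset.sum_comm]
      exact Finset.sum_congr rfl fun k _ => Finset.sum_comm
    exact sub_eq_zero.mp (Fintype.linearIndependent_iff.mp hK _ this (k, l))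
  refine LinearMap.ext fun X => ?_
  calc krausMap L X = ∑ k, ∑ l, (∑ m, star (c m l) * c m k) • (K k * X * (K l)ᴴ) := by
        simp_rw [krausMap_apply, ← hc, Matrix.conjTranspose_sum, Finset.sum_mul, Finset.mul_sum,
          Matrix.conjTranspose_smul, smul_mul_assoc, mul_smul_comm, smul_smul, Finset.sum_smul]
        rw [Finset.sum_comm]
        simp_rw [mul_comm (c _ _)]
        exact Finset.sum_congr rfl fun k _ => Finset.sum_comm
    _ = krausMap K X := by
        simp_rw [hunitary, ite_smul, one_smul, zero_smul, Finset.sum_ite_eq', Finset.mem_univ,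
          if_true, krausMap_apply]

/-- The Choi matrix of a linear map, whose block at `(k, l)` is the image of the matrix unit. -/
def choi (Φ : Matrix n n ℂ →ₗ[ℂ] Matrix n n ℂ) : Matrix (n × n) (n × n) ℂ :=
  Matrix.of fun r s => Φ (Matrix.single r.2 s.2 1) r.1 s.1

lemma exists_eq_krausMap_of_posSemidef_choi {Φ : Matrix n n ℂ →ₗ[ℂ] Matrix n n ℂ}
    (hΦ : (choi Φ).PosSemidef) : ∃ K : n × n → Matrix n n ℂ, Φ = krausMap K := by
  obtain ⟨B, hB⟩ : ∃ B, choi Φ = star B * B := by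
    open scoped MatrixOrder in exact CStarAlgebra.nonneg_iff_eq_star_mul_self.mp hΦ.nonneg
  refine ⟨fun m => Matrix.of fun i k => star (B m (i, k)),
    Matrix.ext_linearMap (R := ℂ) fun k l => LinearMap.ext_ring ?_⟩
  ext i j
  have h : Φ (Matrix.single k l 1) i j = ∑ m, star (B m (i, k)) * B m (j, l) :=
    congrFun (congrFun hB (i, k)) (j, l)
  simp [krausMap_apply, h, Matrix.sum_apply, mul_single_mul_conjTranspose_apply]

end Kraus

section Channels

variable {κ : Type*} [Fintype κ]

lemma applyA_krausMap {ι : Type} [Fintype ι] [DecidableEq ι] (K : κ → Op)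
    (X : Matrix (Fin 2 × ι) (Fin 2 × ι) ℂ) :
    applyA (krausMap K) X =
      ∑ k, (K k ⊗ₖ (1 : Matrix ι ι ℂ)) * X * (K k ⊗ₖ (1 : Matrix ι ι ℂ))ᴴ := by
  ext ⟨i, k⟩ ⟨j, l⟩
  simp [applyA, krausMap_apply, Matrix.sum_apply, Matrix.mul_apply, Fintype.sum_prod_type,
    Matrix.one_apply, apply_ite (starRingEnd ℂ)]

lemma isCPTP_krausMap {K : κ → Op} (hK : ∑ k, (K k)ᴴ * K k = 1) : IsCPTP (krausMap K) := by
  refine ⟨fun n X hX => ?_, fun X => by rw [trace_krausMap, hK, one_mul]⟩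
  rw [applyA_krausMap]
  exact Matrix.posSemidef_sum _ fun k _ => hX.mul_mul_conjTranspose_same _

lemma sum_conjTranspose_mul_self_eq_one_of_isCPTP {K : κ → Op} (h : IsCPTP (krausMap K)) :
    ∑ k, (K k)ᴴ * K k = 1 :=
  Matrix.ext_iff_trace_mul_right.mpr fun X => by rw [← trace_krausMap, h.2, one_mul]

lemma IsCPTP.posSemidef_choi {Φ : Op →ₗ[ℂ] Op} (h : IsCPTP Φ) : (choi Φ).PosSemidef := by
  let ω : Fin 2 × Fin 2 → ℂ := fun r => if r.1 = r.2 then 1 else 0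
  have hω : choi Φ = applyA Φ (Matrix.vecMulVec ω (star ω)) := by
    ext r s
    simp only [choi, applyA, Matrix.of_apply]
    refine congrArg (fun X => Φ X r.1 s.1) (Matrix.ext fun i j => ?_)
    by_cases hi : r.2 = i <;> by_cases hj : s.2 = j <;>
      simp [ω, Matrix.vecMulVec_apply, hi, hj, eq_comm (a := i), eq_comm (a := j)]
  rw [hω]
  exact h.1 2 _ (Matrix.posSemidef_vecMulVec_self_star ω)

theorem krausMap_mem_extremePoints {K : κ → Op} (hK : ∑ k, (K k)ᴴ * K k = 1)
    (hind : LinearIndependent ℂ fun kl : κ × κ => (K kl.1)ᴴ * K kl.2) :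
    krausMap K ∈ Set.extremePoints ℝ {Φ | IsCPTP Φ} := by
  refine ⟨isCPTP_krausMap hK, ?_⟩
  rintro Φ hΦ Ψ hΨ ⟨p, q, hp, hq, -, h⟩
  obtain ⟨L, rfl⟩ := exists_eq_krausMap_of_posSemidef_choi (IsCPTP.posSemidef_choi hΦ)
  obtain ⟨L', rfl⟩ := exists_eq_krausMap_of_posSemidef_choi (IsCPTP.posSemidef_choi hΨ)
  refine krausMap_eq_of_mem_span_range (mem_span_range_of_krausMap_eq_add hp hq.le h.symm) hind ?_
  rw [hK, sum_conjTranspose_mul_self_eq_one_of_isCPTP hΦ]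

end Channels

section ExtremalChannels

/-- Kraus operators of the extremal qubit channel with parameters `y - x` and `y + x`; in these
half-angle coordinates their entries are single trigonometric functions. -/
def extremalKraus (x y : ℝ) : Fin 2 → Op :=
  ![!![(Real.cos x : ℂ), 0; 0, (Real.cos y : ℂ)], !![0, (Real.sin y : ℂ); (Real.sin x : ℂ), 0]]

lemma conjTranspose_extremalKraus (x y : ℝ) (k : Fin 2) :
    (extremalKraus x y k)ᴴ = (extremalKraus x y k)ᵀ := by
  ext i j
  fin_cases k <;> fin_cases i <;> fin_cases j <;>
    simp [extremalKraus, ← Complex.cos_conj, ← Complex.sin_conj]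

lemma extremalChannel_eq_krausMap (x y : ℝ) :
    extremalChannel (y - x) (y + x) = krausMap (extremalKraus x y) := by
  have hx : Complex.cos x ^ 2 = 1 - Complex.sin x ^ 2 := Complex.cos_sq' _
  have hy : Complex.cos y ^ 2 = 1 - Complex.sin y ^ 2 := Complex.cos_sq' _
  refine LinearMap.ext fun X => ?_
  rw [krausMap_apply, extremalChannel]
  simp_rw [conjTranspose_extremalKraus]
  ext i j
  fin_cases i <;> fin_cases j <;>
    simp [pauliMap, extremalMatrix, extremalKraus, pauli, Fin.sum_univ_succ, Matrix.trace_fin_two,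
      Matrix.mul_apply, Matrix.smul_apply, Complex.cos_add, Complex.cos_sub, Complex.sin_add,
      Complex.sin_sub, Matrix.vecHead, Matrix.vecTail, Matrix.vecMul, dotProduct] <;>
    ring_nf <;> simp only [hx, hy, Complex.I_sq] <;> ring

lemma sum_conjTranspose_mul_extremalKraus (x y : ℝ) :
    ∑ k, (extremalKraus x y k)ᴴ * extremalKraus x y k = 1 := by
  simp_rw [conjTranspose_extremalKraus]
  ext i j
  fin_cases i <;> fin_cases j <;>
    simp [extremalKraus, Matrix.mul_apply, ← sq]

lemma linearIndependent_conjTranspose_mul_extremalKraus {x y : ℝ}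
    (h : Real.sin (y - x) * Real.sin (y + x) ≠ 0) :
    LinearIndependent ℂ
      fun kl : Fin 2 × Fin 2 => (extremalKraus x y kl.1)ᴴ * extremalKraus x y kl.2 := by
  have hdet : (Complex.cos x * Complex.sin y) ^ 2 - (Complex.sin x * Complex.cos y) ^ 2 ≠ 0 := by
    convert Complex.ofReal_ne_zero.mpr h using 1
    push_cast
    rw [Complex.sin_sub, Complex.sin_add]
    ring
  rw [Fintype.linearIndependent_iff]
  intro g hg
  have entry (i j : Fin 2) := congrFun (congrFun hg i) j
  simp only [Matrix.sum_apply, conjTranspose_extremalKraus] at entry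
  have h00 := entry 0 0
  have h01 := entry 0 1
  have h10 := entry 1 0
  have h11 := entry 1 1
  simp only [extremalKraus, Complex.ofReal_cos, Complex.ofReal_sin, Fin.isValue, Matrix.smul_apply,
    Matrix.mul_apply, Matrix.transpose_apply, Fin.sum_univ_two, smul_eq_mul, Fintype.sum_prod_type,
    Matrix.cons_val_zero, Matrix.of_apply, Matrix.cons_val', Matrix.cons_val_fin_one,
    Matrix.cons_val_one, mul_zero, add_zero, zero_add, zero_mul,
    Matrix.zero_apply] at h00 h01 h10 h11
  have eq_zero {z : ℂ} := (mul_eq_zero_iff_right (a := z) hdet).mp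
  simp only [Prod.forall, Fin.forall_fin_two]
  refine ⟨⟨eq_zero ?_, eq_zero ?_⟩, eq_zero ?_, eq_zero ?_⟩
  · linear_combination Complex.sin y ^ 2 * h00 - Complex.sin x ^ 2 * h11
  · linear_combination Complex.cos x * Complex.sin y * h01 - Complex.sin x * Complex.cos y * h10
  · linear_combination Complex.cos x * Complex.sin y * h10 - Complex.sin x * Complex.cos y * h01
  · linear_combination Complex.cos x ^ 2 * h11 - Complex.cos y ^ 2 * h00

theorem extremalChannel_mem_extremePoints {u v : ℝ} (h : Real.sin u * Real.sin v ≠ 0) :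
    extremalChannel u v ∈ Set.extremePoints ℝ {Φ | IsCPTP Φ} := by
  obtain ⟨x, y, rfl, rfl⟩ : ∃ x y : ℝ, u = y - x ∧ v = y + x :=
    ⟨(v - u) / 2, (v + u) / 2, by ring, by ring⟩
  rw [extremalChannel_eq_krausMap]
  exact krausMap_mem_extremePoints (sum_conjTranspose_mul_extremalKraus x y)
    (linearIndependent_conjTranspose_mul_extremalKraus h)

end ExtremalChannels

section TStates

/- The vectors in this decomposition are the Pauli matrices read as vectors of the two-qubit space;
up to normalisation and phases they are the Bell basis. -/
lemma tState_eq_sum_bell (t : Fin 3 → ℝ) :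
    tState t = ∑ k, ((![1 + t 0 - t 1 + t 2, 1 + t 0 + t 1 - t 2, 1 - t 0 - t 1 - t 2,
      1 - t 0 + t 1 + t 2] k / 8 : ℝ) : ℂ) •
        Matrix.vecMulVec (Function.uncurry (pauli k)) (star (Function.uncurry (pauli k))) := by
  ext ⟨i, k⟩ ⟨j, l⟩
  fin_cases i <;> fin_cases j <;> fin_cases k <;> fin_cases l <;>
    simp [tState, blochState, pauli, Fin.sum_univ_succ, Matrix.vecMulVec_apply,
      Function.uncurry] <;> ring

lemma isState_tState {t : Fin 3 → ℝ} (h0 : 0 ≤ 1 + t 0 - t 1 + t 2) (h1 : 0 ≤ 1 + t 0 + t 1 - t 2)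
    (h2 : 0 ≤ 1 - t 0 - t 1 - t 2) (h3 : 0 ≤ 1 - t 0 + t 1 + t 2) : IsState (tState t) := by
  constructor
  · rw [tState_eq_sum_bell]
    refine Matrix.posSemidef_sum _ fun k _ => (Matrix.posSemidef_vecMulVec_self_star _).smul ?_
    rw [Complex.zero_le_real]
    fin_cases k <;> exact div_nonneg ‹_› (by norm_num)
  · simp [tState, blochState, pauli, Fin.sum_univ_succ, Matrix.trace, Fintype.sum_prod_type]
    ring

lemma trace_pauli_mul_pauli (m n : Fin 4) :
    (pauli m * pauli n).trace = if m = n then 2 else 0 := by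
  fin_cases m <;> fin_cases n <;> simp [pauli, Matrix.trace_fin_two, one_add_one_eq_two]

lemma pauliMap_pauli (M : Matrix (Fin 4) (Fin 4) ℝ) (n : Fin 4) :
    pauliMap M (pauli n) = ∑ m, (M m n : ℂ) • pauli m := by
  simp [pauliMap, trace_pauli_mul_pauli, ite_div, ite_smul]

lemma applyA_blochState (Φ : Op →ₗ[ℂ] Op) (a : E3) (T : Matrix (Fin 3) (Fin 3) ℝ) :
    applyA Φ (blochState a T) = (1 / 4 : ℂ) • (Φ 1 ⊗ₖ (1 : Op)
      + (∑ i : Fin 3, (a i : ℂ) • (Φ (pauli i.succ) ⊗ₖ (1 : Op)))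
      + ∑ i : Fin 3, ∑ j : Fin 3, (T i j : ℂ) • (Φ (pauli i.succ) ⊗ₖ pauli j.succ)) := by
  ext r s
  have hblock : (Matrix.of fun i i' => blochState a T (i, r.2) (i', s.2)) =
      (1 / 4 : ℂ) • ((1 : Op) r.2 s.2 • (1 : Op)
        + (∑ i : Fin 3, (a i : ℂ) • (1 : Op) r.2 s.2 • pauli i.succ)
        + ∑ i : Fin 3, ∑ j : Fin 3, (T i j : ℂ) • pauli j.succ r.2 s.2 • pauli i.succ) := by
    ext i i'
    simp [blochState, Matrix.sum_apply, mul_comm, -Matrix.kroneckerMap_one_one]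
  simp [applyA, hblock, Matrix.sum_apply, mul_comm, mul_add]

lemma applyA_extremalChannel_tState (u v : ℝ) (t : Fin 3 → ℝ) :
    applyA (extremalChannel u v) (tState t) =
      blochState ((Real.sin u * Real.sin v) • ez)
        (Matrix.diagonal ![Real.cos u * t 0, Real.cos v * t 1, Real.cos u * Real.cos v * t 2]) := by
  have hone : extremalChannel u v 1 = 1 + ((Real.sin u * Real.sin v : ℝ) : ℂ) • pauli 3 := by
    rw [show (1 : Op) = pauli 0 from rfl, extremalChannel, pauliMap_pauli]
    simp [extremalMatrix, Fin.sum_univ_four, -Complex.coe_smul]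
  have hsigma : ∀ i : Fin 3, extremalChannel u v (pauli i.succ) =
      ((![Real.cos u, Real.cos v, Real.cos u * Real.cos v] i : ℝ) : ℂ) • pauli i.succ := by
    intro i
    rw [extremalChannel, pauliMap_pauli]
    fin_cases i <;> simp [extremalMatrix, Fin.sum_univ_four, -Complex.coe_smul]
  rw [tState, applyA_blochState, blochState, hone]
  simp only [hsigma, Fin.sum_univ_three, Matrix.add_kronecker, Matrix.smul_kronecker]
  simp [ez, smul_smul, mul_comm]

lemma isState_tState_of_two_mul_abs_le {x z : ℝ} (hz : -1 ≤ z) (h : 2 * |x| ≤ 1 - z) :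
    IsState (tState ![x, x, z]) := by
  have := neg_abs_le x
  have := le_abs_self x
  apply isState_tState <;> simp <;> linarith

lemma applyA_extremalChannel_tState_eq_displacedWerner {a u : ℝ}
    (hu : Real.sin u * Real.sin u = a) (hc : Real.cos u ≠ 0) (ξ : ℝ) :
    applyA (extremalChannel u u)
      (tState ![-ξ / Real.cos u, -ξ / Real.cos u, -ξ / Real.cos u ^ 2]) =
        displacedWerner (a • ez) ξ := by
  rw [applyA_extremalChannel_tState, hu, displacedWerner]
  congr 1
  ext i j
  fin_cases i <;> fin_cases j <;> simp [field]

lemma exists_tState_preimage {a : ℝ} (ha0 : 0 < a) (ha1 : a < 1) {u : ℝ}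
    (hu : Real.sin u * Real.sin u = a) {ξ : ℝ} (hξ0 : 0 ≤ ξ)
    (hξ : ξ ≤ √(1 - a) * (bracket a)⁻¹) :
    ∃ t : Fin 3 → ℝ, IsState (tState t) ∧ borderIntegral (Matrix.diagonal t) ≤ 1 ∧
      (borderIntegral (Matrix.diagonal t) = 1 ↔ ξ = √(1 - a) * (bracket a)⁻¹) ∧
      applyA (extremalChannel u u) (tState t) = displacedWerner (a • ez) ξ := by
  have ha : 0 < 1 - a := sub_pos.mpr ha1
  have hcos_sq : Real.cos u ^ 2 = 1 - a := by rw [Real.cos_sq', ← hu, sq]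
  have hcos : Real.cos u ≠ 0 := fun h => by simp [h, ha.ne] at hcos_sq
  have habs : |-ξ / Real.cos u| = ξ / √(1 - a) := by
    rw [abs_div, abs_neg, abs_of_nonneg hξ0, ← hcos_sq, Real.sqrt_sq_eq_abs]
  have hB : 2 ≤ bracket a := two_le_bracket ha0 ha1
  have hB0 : 0 < bracket a := two_pos.trans_le hB
  have hborder : borderIntegral (Matrix.diagonal
      ![-ξ / Real.cos u, -ξ / Real.cos u, -ξ / Real.cos u ^ 2]) = ξ / √(1 - a) * bracket a := by
    rw [borderIntegral_diagonal ha0 ha1, habs]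
    rw [← hcos_sq]
    field
  have hx_nonneg : 0 ≤ ξ / √(1 - a) := by positivity
  have hle : ξ / √(1 - a) * bracket a ≤ 1 := by
    rwa [← div_eq_mul_inv, le_div_iff₀ hB0, ← div_le_one (Real.sqrt_pos.mpr ha),
      ← div_mul_eq_mul_div] at hξ
  refine ⟨_, isState_tState_of_two_mul_abs_le ?_ ?_, hborder.trans_le hle, ?_,
    applyA_extremalChannel_tState_eq_displacedWerner hu hcos ξ⟩
  · have hz : -ξ / Real.cos u ^ 2 = -(ξ / √(1 - a) * (1 / √(1 - a))) := by
      rw [hcos_sq, div_mul_div_comm, Real.mul_self_sqrt ha.le, mul_one, neg_div]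
    rw [hz, neg_le_neg_iff]
    exact (mul_le_mul_of_nonneg_left (one_div_sqrt_le_bracket a) hx_nonneg).trans hle
  · have hz : -ξ / Real.cos u ^ 2 ≤ 0 :=
      div_nonpos_of_nonpos_of_nonneg (neg_nonpos.mpr hξ0) (sq_nonneg _)
    rw [habs]
    linarith [mul_le_mul_of_nonneg_left hB hx_nonneg]
  · rw [hborder, div_mul_eq_mul_div, div_eq_one_iff_eq (Real.sqrt_pos.mpr ha).ne',
      ← div_eq_mul_inv, eq_div_iff hB0.ne']

end TStates

end QubitSteering

end

theorem mainTheorem2 (a : ℝ) (ha0 : 0 < a) (ha1 : a < 1) :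
    (∀ (w : QubitSteering.E3) (ξ : ℝ), ‖w‖ = a →
      QubitSteering.IsState (QubitSteering.displacedWerner w ξ) →
      ξ ≤ (1 - a) * (QubitSteering.bracket a)⁻¹ →
      QubitSteering.NonSteerable (QubitSteering.displacedWerner w ξ)) ∧
    (∀ (w : QubitSteering.E3) (ξ : ℝ), ‖w‖ = a →
      QubitSteering.IsState (QubitSteering.displacedWerner w ξ) →
      ξ ≤ Real.sqrt (1 - a) * (QubitSteering.bracket a)⁻¹ →
      QubitSteering.NonSteerable (QubitSteering.displacedWerner w ξ)) ∧
    (∀ u : ℝ, Real.sin u * Real.sin u = a →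
      QubitSteering.extremalChannel u u ∈
        Set.extremePoints ℝ {Φ | QubitSteering.IsCPTP Φ} ∧
      ∀ ξ : ℝ, 0 ≤ ξ → ξ ≤ Real.sqrt (1 - a) * (QubitSteering.bracket a)⁻¹ →
        ∃ t : Fin 3 → ℝ,
          QubitSteering.IsState (QubitSteering.tState t) ∧
          QubitSteering.borderIntegral (Matrix.diagonal t) ≤ 1 ∧
          (QubitSteering.borderIntegral (Matrix.diagonal t) = 1 ↔
            ξ = Real.sqrt (1 - a) * (QubitSteering.bracket a)⁻¹) ∧
          QubitSteering.applyA (QubitSteering.extremalChannel u u) (QubitSteering.tState t) =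
            QubitSteering.displacedWerner (a • QubitSteering.ez) ξ) := by
  have nonSteerable (w : QubitSteering.E3) (ξ : ℝ) (hw : ‖w‖ = a)
      (hstate : QubitSteering.IsState (QubitSteering.displacedWerner w ξ))
      (hξ : ξ ≤ √(1 - a) * (QubitSteering.bracket a)⁻¹) :
      QubitSteering.NonSteerable (QubitSteering.displacedWerner w ξ) :=
    QubitSteering.nonSteerable_displacedWerner ha0 ha1 hw hstate hξ
  have h_bracket : 0 ≤ (QubitSteering.bracket a)⁻¹ :=
    inv_nonneg.mpr (two_pos.le.trans (QubitSteering.two_le_bracket ha0 ha1))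
  have h_sqrt : 1 - a ≤ √(1 - a) := Real.le_sqrt_of_sq_le (by nlinarith)
  refine ⟨fun w ξ hw hstate hξ => ?_, nonSteerable, fun u hu => ⟨?_, fun ξ hξ0 hξ => ?_⟩⟩
  · exact nonSteerable w ξ hw hstate (hξ.trans (mul_le_mul_of_nonneg_right h_sqrt h_bracket))
  · exact QubitSteering.extremalChannel_mem_extremePoints (by rw [hu]; exact ha0.ne')
  · exact QubitSteering.exists_tState_preimage ha0 ha1 hu hξ0 hξ
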